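/- For $n\ge 0$ let $B_n$ be the group of bijections $\beta$ of $[-n,n]\setminus\{0\}$ with $\beta(-i)=-\beta(i)$ for all $i$, and let $D_n\subseteq B_n$ consist of those $\beta$ for which $|\{i\in[n]:\beta(i)<0\}|$ is even. Elements are written $[\beta(1),\dots,\beta(n)]$. Let $\ell_B$ be the length function of $B_n$ with respect to the generators $s_i=[1,\dots,i-1,i+1,i,i+2,\dots,n]$ $(1\le i\le n-1)$ and $s_0^B=[-1,2,\dots,n]$ (for $n\ge1$), and $\ell_D$ the length function of $D_n$ with respect to $s_1,\dots,s_{n-1}$ and $s_0^D=[-2,-1,3,\dots,n]$ (the last for $n\ge 2$). Put $\operatorname{Des}(\beta)=\{i\in[n-1]:\beta(i)>\beta(i+1)\}$ and define the multisets $$\operatorname{NDes}(\beta)=\operatorname{Des}(\beta)\uplus\{-\beta(i): i\in[n],\ \beta(i)<0\}\quad(\beta\in B_n),$$ $$\operatorname{DDes}(\gamma)=\bigl(\operatorname{Des}(\gamma)\uplus\{-\gamma(i)-1: i\in[n],\ \gamma(i)<0\}\bigr)\setminus\{0\}\quad(\gamma\in D_n).$$ Let $\operatorname{nmaj}(\beta)$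 and $\operatorname{ndes}(\beta)$ be the sum and the number of the elements of $\operatorname{NDes}(\beta)$, counted with multiplicity, and let $\operatorname{dmaj}(\gamma)$ and $\operatorname{ddes}(\gamma)$ be the sum and the number of the elements of $\operatorname{DDes}(\gamma)$, counted likewise. Write $[n]_q=1+q+\dots+q^{n-1}$, $[n]_q!=[n]_q\cdots[1]_q$, $(a;q)_n=\prod_{i=0}^{n-1}(1-aq^i)$ and $e[x]_q=\sum_{n\ge0}x^n/[n]_q!$. Then, as formal power series in the indeterminates $t,q,p,u$ over any field (all sums over $n$ and $k$ converging as formal power series), $$\sum_{n\ge0}\frac{u^n}{[n]_q!}\,\frac{\sum_{\beta\in B_n}t^{\operatorname{nmaj}(\beta)}q^{\ell_B(\beta)}p^{\operatorname{ndes}(\beta)}}{(-tqp;tq)_n\,(p;t)_{n+1}}=\sum_{k\ge0}p^k\,e[u]_q\,e[tu]_q\cdots e[t^ku]_q,$$ $$\frac1{1-p}+\sum_{n\ge1}\frac{u^n}{[n]_q!}\,\frac{\sum_{\gamma\in D_n}t^{\operatorname{dmaj}(\gamma)}q^{\ell_D(\gamma)}p^{\operatorname{ddes}(\gamma)}}{(-tqp;tq)_{n-1}\,(p;t)_{n+1}}=\sum_{k\ge0}p^k\,e[u]_q\,e[tu]_q\cdots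 e[t^ku]_q.$$ -/

import Mathlib

open Finset
open scoped MvPowerSeries.WithPiTopology

namespace GesselBD

/-- The set `[-n,n] \ {0}` of nonzero integers of absolute value at most `n`. -/
abbrev PM (n : ℕ) : Type := {i : ℤ // i ≠ 0 ∧ -(n : ℤ) ≤ i ∧ i ≤ (n : ℤ)}

noncomputable instance (n : ℕ) : Fintype (PM n) :=
  Fintype.subtype ((Finset.Icc (-(n : ℤ)) (n : ℤ)).erase 0) (by simp)

/-- The group `B_n` of signed permutations: the bijections `β` of `[-n,n] \ {0}` onto itself with
`β(-i) = -β(i)` for all `i`, under composition. -/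
def B (n : ℕ) : Subgroup (Equiv.Perm (PM n)) where
  carrier := {β | ∀ i j : PM n, (j : ℤ) = -(i : ℤ) → (β j : ℤ) = -(β i : ℤ)}
  mul_mem' := fun {a b} ha hb i j h => ha (b i) (b j) (hb i j h)
  one_mem' := fun _ _ h => h
  inv_mem' := by
    intro a ha i j h
    have hi : -((a⁻¹ i : PM n) : ℤ) ≠ 0 ∧ -(n : ℤ) ≤ -((a⁻¹ i : PM n) : ℤ) ∧
        -((a⁻¹ i : PM n) : ℤ) ≤ (n : ℤ) := by
      have := (a⁻¹ i).2
      omega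
    have h1 := ha (a⁻¹ i) ⟨_, hi⟩ rfl
    have h2 : a ⟨_, hi⟩ = j := by
      apply Subtype.ext
      rw [h1, h]
      simp
    have h3 : a⁻¹ j = ⟨_, hi⟩ := by
      rw [← h2]; simp
    rw [h3]

noncomputable instance (n : ℕ) : DecidablePred (· ∈ B n) := fun β =>
  inferInstanceAs (Decidable (∀ i j : PM n, (j : ℤ) = -(i : ℤ) → (β j : ℤ) = -(β i : ℤ)))

/-- The entry `β(i)`, `1 ≤ i ≤ n`, of the window `[β(1), …, β(n)]` (and `0` for other `i`). -/
def entry {n : ℕ} (β : B n) (i : ℕ) : ℤ :=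
  if h : (i : ℤ) ≠ 0 ∧ -(n : ℤ) ≤ (i : ℤ) ∧ (i : ℤ) ≤ (n : ℤ) then
    ((β : Equiv.Perm (PM n)) ⟨(i : ℤ), h⟩ : ℤ) else 0

/-- `β` has the window `[f(1), …, f(n)]`. -/
def HasWindow {n : ℕ} (β : B n) (f : ℕ → ℤ) : Prop :=
  ∀ j ∈ Finset.Icc 1 n, entry β j = f j

/-- The generators `s_i = [1, …, i-1, i+1, i, i+2, …, n]`, `1 ≤ i ≤ n-1`. -/
def adjacentGens (n : ℕ) : Set (B n) :=
  {s | ∃ i : ℕ, 1 ≤ i ∧ i + 1 ≤ n ∧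
    HasWindow s (fun j => if j = i then (i : ℤ) + 1 else if j = i + 1 then (i : ℤ) else j)}

/-- The generators `S_B`: the `s_i`, `1 ≤ i ≤ n-1`, and `s_0^B = [-1, 2, …, n]`. -/
def gensB (n : ℕ) : Set (B n) :=
  adjacentGens n ∪ {s | 1 ≤ n ∧ HasWindow s (fun j => if j = 1 then -1 else j)}

/-- The generators `S_D`: the `s_i`, `1 ≤ i ≤ n-1`, and `s_0^D = [-2, -1, 3, …, n]`
(the latter for `n ≥ 2` only). -/
def gensD (n : ℕ) : Set (B n) :=
  adjacentGens n ∪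
    {s | 2 ≤ n ∧ HasWindow s (fun j => if j = 1 then -2 else if j = 2 then -1 else j)}

/-- The least length of a word in `S` with product `g`. -/
noncomputable def wordLength {G : Type*} [Group G] (S : Set G) (g : G) : ℕ :=
  sInf {m : ℕ | ∃ l : List G, l.length = m ∧ (∀ s ∈ l, s ∈ S) ∧ l.prod = g}

/-- The length function `ℓ_B` with respect to `S_B`. -/
noncomputable def lengthB {n : ℕ} (β : B n) : ℕ := wordLength (gensB n) β

/-- The length function `ℓ_D` with respect to `S_D` (meaningful for elements of `D_n`). -/
noncomputable def lengthD {n : ℕ} (γ : B n) : ℕ := wordLength (gensD n) γ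

/-- The positions `i ∈ [n]` with `β(i) < 0`. -/
def negPos {n : ℕ} (β : B n) : Finset ℕ := {i ∈ Finset.Icc 1 n | entry β i < 0}

/-- The elements of `D_n`: signed permutations with an even number of negative entries. -/
noncomputable def D (n : ℕ) : Finset (B n) := {β | Even (negPos β).card}

/-- The descents: `i ∈ [n-1]` with `β(i) > β(i+1)`. -/
def des {n : ℕ} (β : B n) : Finset ℕ := {i ∈ Finset.Icc 1 (n - 1) | entry β (i + 1) < entry β i}

/-- The multiset `NDes(β) = Des(β) ⊎ {-β(i) : β(i) < 0}`. -/
def NDes {n : ℕ} (β : B n) : Multiset ℕ :=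
  (des β).val + (negPos β).val.map (fun i => (-entry β i).toNat)

def nmaj {n : ℕ} (β : B n) : ℕ := (NDes β).sum

def ndes {n : ℕ} (β : B n) : ℕ := (NDes β).card

/-- The multiset `DDes(γ) = (Des(γ) ⊎ {-γ(i)-1 : γ(i) < 0}) \ {0}`. -/
def DDes {n : ℕ} (γ : B n) : Multiset ℕ :=
  ((des γ).val + (negPos γ).val.map (fun i => (-entry γ i - 1).toNat)).filter (· ≠ 0)

def dmaj {n : ℕ} (γ : B n) : ℕ := (DDes γ).sum

def ddes {n : ℕ} (γ : B n) : ℕ := (DDes γ).card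

/-- `[n]_q = 1 + q + ⋯ + q^(n-1)`. -/
def qNat {R : Type*} [CommRing R] (q : R) (n : ℕ) : R := ∑ i ∈ Finset.range n, q ^ i

/-- `[n]_q! = [n]_q [n-1]_q ⋯ [1]_q`. -/
def qFact {R : Type*} [CommRing R] (q : R) (n : ℕ) : R := ∏ i ∈ Finset.range n, qNat q (i + 1)

/-- `(a;q)_n = (1-a)(1-aq)⋯(1-aq^(n-1))`. -/
def qPoch {R : Type*} [CommRing R] (a q : R) (n : ℕ) : R := ∏ i ∈ Finset.range n, (1 - a * q ^ i)

/-- The `q`-exponential `e[x]_q = ∑_{n ≥ 0} x^n / [n]_q!`, as a sum of formal power series. -/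
noncomputable def qExp {σ K : Type*} [Field K] [TopologicalSpace K]
    (q x : MvPowerSeries σ K) : MvPowerSeries σ K :=
  ∑' n : ℕ, x ^ n * (qFact q n)⁻¹

/-- The series defining `e[x]_q` converges when `x` has no constant term. -/
theorem summable_qExp {σ K : Type*} [Field K] [TopologicalSpace K]
    (q x : MvPowerSeries σ K) (hx : MvPowerSeries.constantCoeff x = 0) :
    Summable (fun n : ℕ => x ^ n * (qFact q n)⁻¹) := by
  apply MvPowerSeries.WithPiTopology.summable_of_tendsto_order_atTop_nhds_top
  have h1 : ∀ n : ℕ, (n : ℕ∞) ≤ (x ^ n * (qFact q n)⁻¹).order := fun n =>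
    calc (n : ℕ∞) ≤ (x ^ n).order := by
          apply le_trans _ (MvPowerSeries.le_order_pow n)
          have : 1 ≤ x.order := MvPowerSeries.one_le_order_iff_constCoeff_eq_zero.2 hx
          simpa using mul_le_mul_of_nonneg_left this (zero_le (a := (n : ℕ∞)))
      _ ≤ (x ^ n).order + ((qFact q n)⁻¹).order := le_self_add
      _ ≤ _ := MvPowerSeries.le_order_mul
  rw [ENat.tendsto_nhds_top_iff_natCast_lt]
  intro m
  filter_upwards [Filter.eventually_gt_atTop m] with n hn
  exact lt_of_lt_of_le (by exact_mod_cast hn) (h1 n)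

end GesselBD

/-! Both formulas reduce to Gessel's formula for the symmetric groups, `exists_hasSum_permSum`.

Reduction. For a window `w`, let `S` be the set of `|wᵢ| - 1` over its negative entries. The windows
with a given `S` are the rearrangements, by a permutation `π`, of one increasing window, so their
descents and inversions are those of `π`. Since `ℓ_B = inv + negPairs + negCount` and `ℓ_D = inv +
negPairs`, where `negPairs` counts the pairs with negative sum and equals `∑_{a ∈ S} a`, all
statistics split into a part from `π` and a part from `S`. In type B an element `a` of `S`
contributes the factor `(tq)^(a+1) p`, so the sum over `S` is `(-tqp;tq)_n`. In type D it
contributes `(tq)^a p` for `a > 0` and `1` for `a = 0`; the element `0` adjusts the parity of `|S|`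
for free, and the sum over even `S` is `(-tqp;tq)_{n-1}`. These products cancel against the
denominators (`sum_B_eq`, `sum_D_eq`).

Symmetric groups. By `coeff_prod_expSeries`, `[n]_q!` times the coefficient of `uⁿ` in `e[u]_q ⋯
e[t^k u]_q` enumerates words of length `n` in the letters `0, …, k` by sum and by the number of
pairs `i < j` with `hᵢ < hⱼ`. Stably sorting a word into decreasing order gives a permutation `π`
with that many inversions and a sequence `k ≥ c₁ ≥ ⋯ ≥ cₙ ≥ 0` that is strict at the descents of `π`
(`wordSum_eq_sum_perm`). Summing over `k` and `c` gives `t^maj p^des / (p;t)_{n+1}`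
(`prod_mul_chainSum`). -/

namespace GesselBD

/-! ### Evaluation and convergence of power series -/

/-- Evaluation of power series over `K⟦σ⟧` at an element without constant term. -/
theorem exists_evalHom {σ K : Type*} [Field K] [TopologicalSpace K] [DiscreteTopology K]
    (x : MvPowerSeries σ K) (hx : MvPowerSeries.constantCoeff x = 0) :
    ∃ ev : PowerSeries (MvPowerSeries σ K) →+* MvPowerSeries σ K,
      ∀ F, HasSum (fun n : ℕ => PowerSeries.coeff n F * x ^ n) (ev F) := by
  obtain rfl : ‹TopologicalSpace K› = ⊥ := DiscreteTopology.eq_bot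
  let _ : UniformSpace K := ⊥
  have hx' : PowerSeries.HasEval x :=
    MvPowerSeries.WithPiTopology.isTopologicallyNilpotent_of_constantCoeff_zero hx
  refine ⟨PowerSeries.eval₂Hom (φ := RingHom.id _) continuous_id hx', fun F => ?_⟩
  rw [PowerSeries.coe_eval₂Hom]
  exact PowerSeries.hasSum_eval₂ (φ := RingHom.id _) continuous_id hx' F

/-- A double series `∑ xᵐ yⁿ f(m,n)` converges when `x` and `y` have no constant term. -/
theorem summable_pow_mul_pow {σ K : Type*} [Field K] [TopologicalSpace K]
    (x y : MvPowerSeries σ K) (hx : MvPowerSeries.constantCoeff x = 0)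
    (hy : MvPowerSeries.constantCoeff y = 0) (f : ℕ → ℕ → MvPowerSeries σ K) :
    Summable (fun i : ℕ × ℕ => x ^ i.1 * y ^ i.2 * f i.1 i.2) := by
  have hpow : ∀ (z : MvPowerSeries σ K), MvPowerSeries.constantCoeff z = 0 →
      ∀ n : ℕ, (n : ℕ∞) ≤ (z ^ n).order := fun z hz n => by
    apply le_trans _ (MvPowerSeries.le_order_pow n)
    have : 1 ≤ z.order := MvPowerSeries.one_le_order_iff_constCoeff_eq_zero.2 hz
    simpa using mul_le_mul_of_nonneg_left this (zero_le (a := (n : ℕ∞)))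
  have hle : ∀ i : ℕ × ℕ, ((i.1 + i.2 : ℕ) : ℕ∞) ≤ (x ^ i.1 * y ^ i.2 * f i.1 i.2).order :=
    fun i => by
      push_cast
      exact (add_le_add (hpow x hx i.1) (hpow y hy i.2)).trans
        (MvPowerSeries.le_order_mul.trans (le_self_add.trans MvPowerSeries.le_order_mul))
  refine Pi.summable.2 fun d => ?_
  apply summable_of_hasFiniteSupport
  refine ((Finset.range (d.degree + 1) ×ˢ Finset.range (d.degree + 1)).finite_toSet).subset ?_
  intro i hi
  rw [Function.mem_support] at hi
  have : ¬ ((d.degree : ℕ∞) < (x ^ i.1 * y ^ i.2 * f i.1 i.2).order) := fun h =>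
    hi (MvPowerSeries.coeff_of_lt_order h)
  have h2 := (hle i).trans (not_lt.1 this)
  have h3 : i.1 + i.2 ≤ d.degree := by exact_mod_cast h2
  simp only [coe_product, coe_range, Set.mem_prod, Set.mem_Iio]
  omega

/-! ### The `q`-derivative and products of `q`-exponentials -/

theorem qNat_succ_add {R : Type*} [CommRing R] (q : R) (i j : ℕ) :
    qNat q (i + j) = qNat q j + q ^ j * qNat q i := by
  rw [qNat, qNat, qNat, add_comm i j, Finset.sum_range_add, Finset.mul_sum]
  simp [pow_add]

/-- The `q`-derivative of a formal power series. -/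
noncomputable def qDeriv {R : Type*} [CommRing R] (q : R) (F : PowerSeries R) : PowerSeries R :=
  PowerSeries.mk fun n => qNat q (n + 1) * PowerSeries.coeff (n + 1) F

/-- After multiplication by `X` the operator acts diagonally on coefficients, without an index
shift. -/
theorem X_mul_qDeriv {R : Type*} [CommRing R] (q : R) (F : PowerSeries R) :
    PowerSeries.X * qDeriv q F = PowerSeries.mk fun n => qNat q n * PowerSeries.coeff n F := by
  ext n
  cases n with
  | zero => simp [qNat]
  | succ n => simp [PowerSeries.coeff_succ_X_mul, qDeriv]

/-- The twist by `rescale q` is the factor `q^j` in `[i+j] = [j] + q^j [i]`. -/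
theorem qDeriv_mul {R : Type*} [CommRing R] (q : R) (F G : PowerSeries R) :
    qDeriv q (F * G) = qDeriv q F * PowerSeries.rescale q G + F * qDeriv q G := by
  have key : PowerSeries.X * qDeriv q (F * G) =
      PowerSeries.X * (qDeriv q F * PowerSeries.rescale q G + F * qDeriv q G) := by
    have : PowerSeries.X * (qDeriv q F * PowerSeries.rescale q G + F * qDeriv q G) =
      (PowerSeries.X * qDeriv q F) * PowerSeries.rescale q G +
        F * (PowerSeries.X * qDeriv q G) := by ring
    rw [this]
    simp only [X_mul_qDeriv]
    ext n
    simp only [PowerSeries.coeff_mk, map_add, PowerSeries.coeff_mul, PowerSeries.coeff_rescale,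
      Finset.mul_sum, ← Finset.sum_add_distrib]
    refine Finset.sum_congr rfl fun i hi => ?_
    rw [← Finset.HasAntidiagonal.mem_antidiagonal.1 hi, qNat_succ_add]
    ring
  ext n
  simpa [PowerSeries.coeff_succ_X_mul] using congrArg (PowerSeries.coeff (n + 1)) key

/-- The series `∑ xⁿ cₙ zⁿ`; the `q`-exponential when `cₙ` is the inverse of `[n]_q!`. -/
noncomputable def expSeries {R : Type*} [CommRing R] (c : ℕ → R) (x : R) : PowerSeries R :=
  PowerSeries.mk fun n => x ^ n * c n

theorem rescale_expSeries {R : Type*} [CommRing R] (q : R) (c : ℕ → R) (x : R) :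
    PowerSeries.rescale q (expSeries c x) = expSeries c (q * x) := by
  ext n
  simp [expSeries, mul_pow, mul_assoc]

theorem qDeriv_expSeries {R : Type*} [CommRing R] (q : R) (c : ℕ → R)
    (hc : ∀ n, qFact q n * c n = 1) (x : R) :
    qDeriv q (expSeries c x) = PowerSeries.C x * expSeries c x := by
  ext n
  have h : qNat q (n + 1) * c (n + 1) = c n := by
    have h1 := hc (n + 1)
    rw [qFact, Finset.prod_range_succ, ← qFact] at h1
    -- The ring is arbitrary, so instead of cancelling `[n]_q!` one inserts `[n]_q! cₙ = 1`.
    calc qNat q (n + 1) * c (n + 1) = (qFact q n * c n) * (qNat q (n + 1) * c (n + 1)) := by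
          rw [hc, one_mul]
      _ = (qFact q n * qNat q (n + 1) * c (n + 1)) * c n := by ring
      _ = c n := by rw [h1, one_mul]
  simp only [qDeriv, expSeries, PowerSeries.coeff_mk, PowerSeries.coeff_C_mul, ← h]
  ring

theorem qDeriv_one {R : Type*} [CommRing R] (q : R) : qDeriv q (1 : PowerSeries R) = 0 := by
  ext n
  simp [qDeriv, PowerSeries.coeff_one]

/-- Iterated twisted Leibniz rule: differentiating factor `a` rescales exactly the factors after it.
This matches the recursion `wordSum_succ`. -/
theorem qDeriv_prod_expSeries {R : Type*} [CommRing R] (q : R) (c : ℕ → R)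
    (hc : ∀ n, qFact q n * c n = 1) (m : ℕ) (x : Fin m → R) :
    qDeriv q (∏ b, expSeries c (x b)) = ∑ a, PowerSeries.C (x a) *
      ∏ b, expSeries c (if a < b then q * x b else x b) := by
  induction m with
  | zero => simp [qDeriv_one]
  | succ m ih =>
    rw [Fin.prod_univ_succ, qDeriv_mul, ih, qDeriv_expSeries q c hc, Fin.sum_univ_succ, map_prod]
    simp only [Fin.prod_univ_succ, rescale_expSeries, Fin.succ_lt_succ_iff, lt_irrefl, if_false,
      Fin.succ_pos, if_true, Fin.not_lt_zero, Finset.mul_sum]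
    congr 1
    · ring
    · refine Finset.sum_congr rfl fun a _ => ?_
      ring

/-! ### Words by content and `coinv` -/

/-- The number of pairs `i < j` with `h i < h j`. -/
def coinv {n m : ℕ} (h : Fin n → Fin m) : ℕ := ∑ i, ∑ j, if i < j ∧ h i < h j then 1 else 0

/-- The generating function of words of length `n` by content and `coinv`. -/
noncomputable def wordSum {R : Type*} [CommRing R] (q : R) {m : ℕ} (x : Fin m → R) (n : ℕ) : R :=
  ∑ h : Fin n → Fin m, q ^ coinv h * ∏ i, x (h i)

theorem coinv_cons {n m : ℕ} (a : Fin m) (h : Fin n → Fin m) :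
    coinv (Fin.cons a h : Fin (n + 1) → Fin m) = (∑ j, if a < h j then 1 else 0) + coinv h := by
  simp only [coinv, Fin.sum_univ_succ, Fin.cons_zero, Fin.cons_succ, Fin.succ_lt_succ_iff,
    Fin.succ_pos, Fin.not_lt_zero, true_and, false_and, if_false, zero_add]

/-- Split off the first letter `a`: each later letter `b > a` forms one new pair with it, and that
`q` is absorbed into the weight of `b`. -/
theorem wordSum_succ {R : Type*} [CommRing R] (q : R) {m : ℕ} (x : Fin m → R) (n : ℕ) :
    wordSum q x (n + 1) = ∑ a, x a * wordSum q (fun b => if a < b then q * x b else x b) n := by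
  rw [wordSum, ← (Fin.consEquiv fun _ => Fin m).sum_comp, Fintype.sum_prod_type]
  refine Finset.sum_congr rfl fun a _ => ?_
  rw [wordSum, Finset.mul_sum]
  refine Finset.sum_congr rfl fun h _ => ?_
  have hcons : (Fin.consEquiv fun _ => Fin m) (a, h) = (Fin.cons a h : Fin (n + 1) → Fin m) := rfl
  simp only [hcons, coinv_cons, Fin.prod_univ_succ, Fin.cons_zero, Fin.cons_succ,
    pow_add, ← Finset.prod_pow_eq_pow_sum]
  have : ∏ i, (if a < h i then q * x (h i) else x (h i)) =
      (∏ i, q ^ (if a < h i then 1 else 0)) * ∏ i, x (h i) := by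
    rw [← Finset.prod_mul_distrib]
    refine Finset.prod_congr rfl fun i _ => ?_
    split_ifs <;> simp
  rw [this]
  ring

/-- The generating function of words is a product of `q`-exponentials. -/
theorem coeff_prod_expSeries {R : Type*} [CommRing R] (q : R) (c : ℕ → R)
    (hc : ∀ n, qFact q n * c n = 1) {m : ℕ} (n : ℕ) (x : Fin m → R) :
    PowerSeries.coeff n (∏ b, expSeries c (x b)) * qFact q n = wordSum q x n := by
  induction n generalizing x with
  | zero =>
    have : c 0 = 1 := by simpa [qFact] using hc 0
    rw [PowerSeries.coeff_zero_eq_constantCoeff_apply, map_prod]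
    simp [wordSum, qFact, coinv, expSeries, this, ← PowerSeries.coeff_zero_eq_constantCoeff_apply]
  | succ n ih =>
    rw [wordSum_succ, qFact, Finset.prod_range_succ, ← qFact]
    have : PowerSeries.coeff n (qDeriv q (∏ b, expSeries c (x b))) =
        qNat q (n + 1) * PowerSeries.coeff (n + 1) (∏ b, expSeries c (x b)) := by
      simp [qDeriv]
    rw [show ∀ A B C : R, A * (B * C) = (C * A) * B by intros; ring, ← this,
      qDeriv_prod_expSeries q c hc, map_sum, Finset.sum_mul]
    refine Finset.sum_congr rfl fun a _ => ?_
    rw [← ih, PowerSeries.coeff_C_mul, mul_assoc]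

/-! ### Chains with prescribed strict steps -/

/-- The generating function of the sequences `k ≥ c₁ + δ₀`, `cᵢ ≥ cᵢ₊₁ + δᵢ`, `cₙ ≥ δₙ`. -/
def chainSum {R : Type*} [CommRing R] (t : R) : (ℕ → ℕ) → ℕ → ℕ → R
  | δ, 0, k => if δ 0 ≤ k then 1 else 0
  | δ, n + 1, k => ∑ a ∈ Finset.range (k + 1 - δ 0), t ^ a * chainSum t (fun i => δ (i + 1)) n a

theorem one_sub_X_mul_mk {R : Type*} [CommRing R] (f : ℕ → R) (G : PowerSeries R)
    (h0 : f 0 = PowerSeries.coeff 0 G)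
    (hs : ∀ k, f (k + 1) = f k + PowerSeries.coeff (k + 1) G) :
    (1 - PowerSeries.X) * PowerSeries.mk f = G := by
  ext k
  rw [sub_mul, one_mul, map_sub]
  cases k with
  | zero => simp [h0]
  | succ k => simp [PowerSeries.coeff_succ_X_mul, hs]

theorem one_sub_X_mul_chainSum_zero {R : Type*} [CommRing R] (t : R) (δ : ℕ → ℕ) :
    (1 - PowerSeries.X) * PowerSeries.mk (chainSum t δ 0) = PowerSeries.X ^ δ 0 := by
  apply one_sub_X_mul_mk
  · simp [chainSum, PowerSeries.coeff_X_pow, eq_comm]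
  · intro k
    simp only [chainSum, PowerSeries.coeff_X_pow]
    rcases lt_trichotomy (δ 0) (k + 1) with h | h | h
    · simp [h.le, Nat.lt_succ_iff.1 h, h.ne']
    · simp [h]
    · simp [h.not_ge, h.ne, (show ¬ δ 0 ≤ k by omega)]

/-- Differencing in `k` keeps only the top value `a = k - δ₀`; its weight `t^a` is the rescaling and
the offset is `X^δ₀`. -/
theorem one_sub_X_mul_chainSum_succ {R : Type*} [CommRing R] (t : R) (δ : ℕ → ℕ) (n : ℕ) :
    (1 - PowerSeries.X) * PowerSeries.mk (chainSum t δ (n + 1)) = PowerSeries.X ^ δ 0 *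
      PowerSeries.rescale t (PowerSeries.mk (chainSum t (fun i => δ (i + 1)) n)) := by
  apply one_sub_X_mul_mk
  · rw [PowerSeries.coeff_X_pow_mul', chainSum]
    by_cases h : δ 0 = 0
    · simp [h]
    · simp [h, show 0 + 1 - δ 0 = 0 by omega]
  · intro k
    rw [PowerSeries.coeff_X_pow_mul', chainSum, chainSum]
    by_cases h : δ 0 ≤ k + 1
    · rw [show k + 1 + 1 - δ 0 = (k + 1 - δ 0) + 1 by omega, Finset.sum_range_succ]
      simp [h]
    · simp [h, show k + 1 - δ 0 = 0 by omega, show k + 1 + 1 - δ 0 = 0 by omega]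

/-- In the induction, rescaling by `t` turns each factor `1 - tⁱX` into `1 - tⁱ⁺¹X`, and on the
right it supplies the power of `t` that raises each index `i` to `i + 1`. -/
theorem prod_mul_chainSum {R : Type*} [CommRing R] (t : R) (δ : ℕ → ℕ) (n : ℕ) :
    (∏ i ∈ Finset.range (n + 1), (1 - PowerSeries.C (t ^ i) * PowerSeries.X)) *
        PowerSeries.mk (chainSum t δ n) =
      PowerSeries.C (t ^ ∑ i ∈ Finset.range (n + 1), i * δ i) *
        PowerSeries.X ^ ∑ i ∈ Finset.range (n + 1), δ i := by
  induction n generalizing δ with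
  | zero => simpa using one_sub_X_mul_chainSum_zero t δ
  | succ n ih =>
    have hX : PowerSeries.rescale t (PowerSeries.X : PowerSeries R) =
        PowerSeries.C t * PowerSeries.X := PowerSeries.rescale_X t
    have hC : PowerSeries.rescale t (PowerSeries.C t) = PowerSeries.C t := by
      ext (_ | m) <;> simp [PowerSeries.coeff_rescale, PowerSeries.coeff_C]
    have h := congrArg (PowerSeries.rescale t) (ih fun i => δ (i + 1))
    rw [map_mul, map_prod] at h
    simp only [map_sub, map_one, map_mul, map_pow, hX, hC] at h
    rw [Finset.prod_range_succ']
    simp only [pow_zero, map_one, one_mul]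
    rw [mul_assoc, one_sub_X_mul_chainSum_succ, mul_left_comm]
    simp only [map_pow] at h ⊢
    have hp : ∏ i ∈ Finset.range (n + 1), (1 - PowerSeries.C t ^ (i + 1) * PowerSeries.X) =
        ∏ i ∈ Finset.range (n + 1),
          (1 - PowerSeries.C t ^ i * (PowerSeries.C t * PowerSeries.X)) :=
      Finset.prod_congr rfl fun i _ => by ring
    rw [hp, h, Finset.sum_range_succ' (fun i => i * δ i), Finset.sum_range_succ' δ]
    simp only [add_mul, one_mul, Finset.sum_add_distrib, zero_mul, add_zero, mul_pow]
    ring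

/-- The condition on the sequences counted by `chainSum`. -/
def IsChainSeq (δ : ℕ → ℕ) (k : ℕ) {n : ℕ} (c : Fin n → ℕ) : Prop :=
  ∀ i : Fin (n + 1), (Fin.snoc c 0 : Fin (n + 1) → ℕ) i + δ i ≤ (Fin.cons k c : Fin (n + 1) → ℕ) i

theorem isChainSeq_cons (δ : ℕ → ℕ) (k a : ℕ) {n : ℕ} (c : Fin n → ℕ) :
    IsChainSeq δ k (Fin.cons a c : Fin (n + 1) → ℕ) ↔
      a + δ 0 ≤ k ∧ IsChainSeq (fun i => δ (i + 1)) a c := by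
  rw [IsChainSeq, Fin.forall_fin_succ, ← Fin.cons_snoc_eq_snoc_cons]
  simp [IsChainSeq]

open Classical in
-- The bound `N` stays fixed while `k` is replaced by the first entry in the induction; as `k < N`,
-- it excludes no chain.
theorem sum_isChainSeq {R : Type*} [CommRing R] (t : R) (N : ℕ) (δ : ℕ → ℕ) (n k : ℕ)
    (hk : k < N) :
    ∑ c : Fin n → Fin N, (if IsChainSeq δ k (fun i => (c i : ℕ)) then ∏ i, t ^ (c i : ℕ) else 0) =
      chainSum t δ n k := by
  induction n generalizing δ k with
  | zero => simp [chainSum, IsChainSeq, Fin.snoc]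
  | succ n ih =>
    rw [← (Fin.consEquiv fun _ => Fin N).sum_comp, Fintype.sum_prod_type]
    have hstep : ∀ a : Fin N, ∑ c : Fin n → Fin N,
        (if IsChainSeq δ k (fun i => ((Fin.consEquiv fun _ => Fin N) (a, c) i : ℕ)) then
          ∏ i, t ^ ((Fin.consEquiv fun _ => Fin N) (a, c) i : ℕ) else 0) =
        if (a : ℕ) + δ 0 ≤ k then t ^ (a : ℕ) * chainSum t (fun i => δ (i + 1)) n a else 0 := by
      intro a
      rw [← ih _ _ a.2]
      have hc : ∀ c : Fin n → Fin N,
          (fun i => ((Fin.consEquiv fun _ => Fin N) (a, c) i : ℕ)) =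
            (Fin.cons (a : ℕ) (fun i => (c i : ℕ)) : Fin (n + 1) → ℕ) := fun c => by
        funext i
        refine Fin.cases ?_ (fun i => ?_) i <;> rfl
      simp only [hc, isChainSeq_cons, Finset.mul_sum]
      by_cases h : (a : ℕ) + δ 0 ≤ k
      · simp only [h, true_and, if_true, mul_ite, mul_zero]
        refine Finset.sum_congr rfl fun c _ => ?_
        rw [Fin.prod_univ_succ]
        rfl
      · simp [h]
    rw [Finset.sum_congr rfl fun a _ => hstep a,
      Fin.sum_univ_eq_sum_range (fun a => if a + δ 0 ≤ k then
        t ^ a * chainSum t (fun i => δ (i + 1)) n a else 0), chainSum, ← Finset.sum_filter]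
    refine Finset.sum_congr ?_ fun _ _ => rfl
    ext a
    simp only [Finset.mem_filter, Finset.mem_range]
    omega

/-! ### Sorting words: from words to permutations -/

/-- The descent indicator of a word `w₁ … wₙ` at `i`, equal to `1` when `wᵢ > wᵢ₊₁`. -/
noncomputable def descentInd {α : Type*} [LinearOrder α] {n : ℕ} (w : Fin n → α) (i : ℕ) : ℕ :=
  open Classical in
  if ∃ (h : i < n), 0 < i ∧ w ⟨i, h⟩ < w ⟨i - 1, by omega⟩ then 1 else 0

/-- The number of inversions of a word. -/
def inversions {α : Type*} [LinearOrder α] {n : ℕ} (w : Fin n → α) : ℕ :=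
  ∑ i, ∑ j, if i < j ∧ w j < w i then 1 else 0

/-- Both sides say that `(cᵢ, πᵢ)` is lexicographically increasing, with the order on the `cᵢ`
reversed; the chain condition checks only neighbours. -/
theorem isChainSeq_descentInd {n : ℕ} (π : Equiv.Perm (Fin n)) (k : ℕ) (c : Fin n → ℕ)
    (hc : ∀ i, c i ≤ k) :
    IsChainSeq (descentInd π) k c ↔
      ∀ i j, i < j → c j < c i ∨ (c i = c j ∧ π i < π j) := by
  cases n with
  | zero => simp [IsChainSeq, descentInd, Fin.snoc]
  | succ n =>
    have hs := Fin.strictMono_iff_lt_succ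
      (f := fun i => toLex (OrderDual.toDual (c i), π i))
    have hl : (∀ i j, i < j → c j < c i ∨ (c i = c j ∧ π i < π j)) ↔
        StrictMono (fun i => toLex (OrderDual.toDual (c i), π i)) := by
      simp only [StrictMono, Prod.Lex.toLex_lt_toLex, OrderDual.toDual_lt_toDual,
        EmbeddingLike.apply_eq_iff_eq]
    rw [hl, hs, IsChainSeq, Fin.forall_fin_succ, Fin.forall_fin_succ']
    simp only [Prod.Lex.toLex_lt_toLex, OrderDual.toDual_lt_toDual, EmbeddingLike.apply_eq_iff_eq]
    -- The two end conditions are automatic, since `descentInd` vanishes at `0` and at the length of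
    -- the word.
    have h0 : (Fin.snoc c 0 : Fin (n + 2) → ℕ) 0 + descentInd π ((0 : Fin (n + 2)) : ℕ) ≤
        (Fin.cons k c : Fin (n + 2) → ℕ) 0 := by
      have : (Fin.snoc c 0 : Fin (n + 2) → ℕ) (Fin.castSucc 0) = c 0 := Fin.snoc_castSucc _ _ _
      rw [Fin.castSucc_zero] at this
      simp [this, descentInd, hc]
    have h1 : (Fin.snoc c 0 : Fin (n + 2) → ℕ) (Fin.last n).succ +
        descentInd π ((Fin.last n).succ : Fin (n + 2)) ≤
        (Fin.cons k c : Fin (n + 2) → ℕ) (Fin.last n).succ := by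
      simp [descentInd]
    simp only [h0, h1, true_and, and_true]
    refine forall_congr' fun i => ?_
    rw [← Fin.castSucc_succ, Fin.snoc_castSucc, Fin.castSucc_succ, Fin.cons_succ]
    have hne : π i.castSucc ≠ π i.succ := fun h =>
      (Fin.castSucc_lt_succ (i := i)).ne (π.injective h)
    have hd : descentInd π (i.castSucc.succ : Fin (n + 2)) =
        if π i.succ < π i.castSucc then 1 else 0 := by
      rw [descentInd]
      congr 1
      simp only [Fin.val_succ, Fin.val_castSucc, Nat.add_lt_add_iff_right, eq_iff_iff]
      constructor
      · rintro ⟨_, _, h⟩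
        exact h
      · intro h
        exact ⟨i.2, by omega, h⟩
    rw [hd]
    rcases lt_or_gt_of_ne hne with h | h
    · simp only [h.not_gt, if_false, h, and_true]
      omega
    · rw [if_pos h]
      have h' : ¬ π i.castSucc < π i.succ := h.not_gt
      simp only [h', and_false, or_false]
      omega

/-- `Tuple.sort` is stable, so it breaks ties by position, which forces strictness of `c` exactly at
the descents of `π`; `Fin.rev` makes the sort decreasing. -/
theorem eq_sort_rev_iff {n N : ℕ} (π : Equiv.Perm (Fin n)) (c : Fin n → Fin (N + 1)) :
    π = Tuple.sort (fun i => Fin.rev (c (π.symm i))) ↔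
      IsChainSeq (descentInd π) N (fun i => (c i : ℕ)) := by
  rw [Tuple.eq_sort_iff, isChainSeq_descentInd _ _ _ fun i => Nat.lt_succ_iff.1 (c i).2]
  have h1 : ((fun i => Fin.rev (c (π.symm i))) ∘ π) = fun i => Fin.rev (c i) := by
    funext i; simp
  rw [h1, monotone_iff_forall_lt]
  simp only [Equiv.symm_apply_apply, Fin.rev_inj, Fin.rev_le_rev, Fin.val_inj,
    Fin.val_fin_lt]
  constructor
  · rintro ⟨ha, hb⟩ i j hij
    exact (ha hij).lt_or_eq.imp_right fun h => ⟨h.symm, hb i j hij h.symm⟩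
  · intro h
    refine ⟨fun i j hij => ?_, fun i j hij he => ?_⟩
    · exact (h i j hij).elim le_of_lt fun h => h.1.ge
    · exact (h i j hij).elim (fun h => absurd he h.ne') And.right

/-- For `i < j` with `π j < π i` the chain condition forces `c j < c i`, so inversions of `π` are
the strictly ascending pairs of the word. -/
theorem coinv_comp_symm {n N : ℕ} (π : Equiv.Perm (Fin n)) (c : Fin n → Fin (N + 1))
    (h : IsChainSeq (descentInd π) N (fun i => (c i : ℕ))) :
    coinv (fun i => c (π.symm i)) = inversions π := by
  rw [isChainSeq_descentInd _ _ _ fun i => Nat.lt_succ_iff.1 (c i).2] at h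
  rw [coinv, inversions, Finset.sum_comm, ← Equiv.sum_comp π]
  refine Finset.sum_congr rfl fun i _ => ?_
  rw [← Equiv.sum_comp π]
  refine Finset.sum_congr rfl fun j _ => ?_
  congr 1
  simp only [Equiv.symm_apply_apply, eq_iff_iff]
  constructor
  · rintro ⟨h1, h2⟩
    refine ⟨?_, h1⟩
    by_contra h3
    rcases (not_lt.1 h3).lt_or_eq with h4 | h4
    · rcases h j i h4 with h5 | h5 <;> simp only [Fin.lt_def] at * <;> omega
    · subst h4
      exact lt_irrefl _ h1
  · rintro ⟨h1, h2⟩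
    refine ⟨h2, ?_⟩
    rcases h i j h1 with h3 | h3
    · exact h3
    · exact absurd h3.2 h2.not_gt

theorem wordSum_eq_sum_perm {R : Type*} [CommRing R] (q t : R) (n k : ℕ) :
    wordSum q (fun b : Fin (k + 1) => t ^ (b : ℕ)) n =
      ∑ π : Equiv.Perm (Fin n), q ^ inversions π * chainSum t (descentInd π) n k := by
  classical
  rw [wordSum, ← Finset.sum_fiberwise (Finset.univ)
    (fun h : Fin n → Fin (k + 1) => Tuple.sort (fun i => Fin.rev (h i)))]
  refine Finset.sum_congr rfl fun π _ => ?_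
  rw [Finset.sum_filter, ← sum_isChainSeq t (k + 1) _ _ _ (Nat.lt_succ_self k), Finset.mul_sum,
    ← (π.arrowCongr (Equiv.refl (Fin (k + 1)))).sum_comp]
  refine Finset.sum_congr rfl fun c _ => ?_
  have hc : (π.arrowCongr (Equiv.refl (Fin (k + 1)))) c = fun i => c (π.symm i) := rfl
  simp only [hc]
  by_cases h : IsChainSeq (descentInd π) k (fun i => (c i : ℕ))
  · rw [if_pos h, if_pos ((eq_sort_rev_iff π c).2 h).symm, coinv_comp_symm π c h,
      π.symm.prod_comp (fun i => t ^ (c i : ℕ))]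
  · rw [if_neg h, if_neg fun h' => h ((eq_sort_rev_iff π c).1 h'.symm), mul_zero]

/-- The generating function of the symmetric group by `maj`, `inv` and `des`. -/
theorem prod_mul_mk_wordSum {R : Type*} [CommRing R] (q t : R) (n : ℕ) :
    (∏ i ∈ Finset.range (n + 1), (1 - PowerSeries.C (t ^ i) * PowerSeries.X)) *
        PowerSeries.mk (fun k => wordSum q (fun b : Fin (k + 1) => t ^ (b : ℕ)) n) =
      ∑ π : Equiv.Perm (Fin n), PowerSeries.C (q ^ inversions π) *
        (PowerSeries.C (t ^ ∑ i ∈ Finset.range (n + 1), i * descentInd π i) *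
          PowerSeries.X ^ ∑ i ∈ Finset.range (n + 1), descentInd π i) := by
  have : PowerSeries.mk (fun k => wordSum q (fun b : Fin (k + 1) => t ^ (b : ℕ)) n) =
      ∑ π : Equiv.Perm (Fin n), PowerSeries.C (q ^ inversions π) *
        PowerSeries.mk (chainSum t (descentInd π) n) := by
    ext k
    simp only [PowerSeries.coeff_mk, wordSum_eq_sum_perm, map_sum, PowerSeries.coeff_C_mul]
  rw [this, Finset.mul_sum]
  refine Finset.sum_congr rfl fun π _ => ?_
  rw [mul_left_comm, prod_mul_chainSum]

/-- The generating function `∑_π t^maj(π) q^inv(π) p^des(π)` over the symmetric group. -/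
noncomputable def permSum {R : Type*} [CommRing R] (t q p : R) (n : ℕ) : R :=
  ∑ π : Equiv.Perm (Fin n), q ^ inversions π *
    (t ^ (∑ i ∈ Finset.range (n + 1), i * descentInd π i) *
      p ^ ∑ i ∈ Finset.range (n + 1), descentInd π i)

theorem permSum_zero {R : Type*} [CommRing R] (t q p : R) : permSum t q p 0 = 1 := by
  simp [permSum, inversions, descentInd]

/-! ### Gessel's formula for the symmetric groups -/

section Series

variable {σ K : Type*} [Field K]

theorem constantCoeff_qFact (q : MvPowerSeries σ K) (hq : MvPowerSeries.constantCoeff q = 0)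
    (n : ℕ) : MvPowerSeries.constantCoeff (qFact q n) = 1 := by
  simp only [qFact, qNat, map_prod, map_sum, map_pow, hq]
  simp [Finset.sum_range_succ']

theorem constantCoeff_qPoch (a q : MvPowerSeries σ K) (ha : MvPowerSeries.constantCoeff a = 0)
    (n : ℕ) : MvPowerSeries.constantCoeff (qPoch a q n) = 1 := by
  simp [qPoch, map_prod, ha]

theorem qFact_mul_inv (q : MvPowerSeries σ K) (hq : MvPowerSeries.constantCoeff q = 0) (n : ℕ) :
    qFact q n * (qFact q n)⁻¹ = 1 :=
  MvPowerSeries.mul_inv_cancel _ (by rw [constantCoeff_qFact q hq]; exact one_ne_zero)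

theorem qPoch_mul_inv (a q : MvPowerSeries σ K) (ha : MvPowerSeries.constantCoeff a = 0) (n : ℕ) :
    qPoch a q n * (qPoch a q n)⁻¹ = 1 :=
  MvPowerSeries.mul_inv_cancel _ (by rw [constantCoeff_qPoch a q ha]; exact one_ne_zero)

theorem mul_inv_qPoch_mul (a p q t A : MvPowerSeries σ K)
    (ha : MvPowerSeries.constantCoeff a = 0) (m n : ℕ) :
    qPoch a q m * A * (qPoch a q m * qPoch p t n)⁻¹ = A * (qPoch p t n)⁻¹ := by
  rw [MvPowerSeries.mul_inv_rev]
  linear_combination (A * (qPoch p t n)⁻¹) * qPoch_mul_inv a q ha m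

variable [TopologicalSpace K] [DiscreteTopology K]

/-- The identity `prod_mul_mk_wordSum`, in a formal variable `X`, is evaluated at `X = p`. -/
theorem hasSum_permSum (t q p : MvPowerSeries σ K) (hp : MvPowerSeries.constantCoeff p = 0)
    (n : ℕ) :
    HasSum (fun k : ℕ => p ^ k * wordSum q (fun b : Fin (k + 1) => t ^ (b : ℕ)) n)
      (permSum t q p n * (qPoch p t (n + 1))⁻¹) := by
  obtain ⟨ev, hev⟩ := exists_evalHom p hp
  have hC : ∀ a, ev (PowerSeries.C a) = a := fun a => by
    refine (hev (PowerSeries.C a)).unique ?_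
    convert hasSum_single (f := fun n : ℕ => PowerSeries.coeff n (PowerSeries.C a) * p ^ n) 0
      (fun n hn => by simp [PowerSeries.coeff_C, hn])
    simp
  have hX : ev PowerSeries.X = p := by
    refine (hev PowerSeries.X).unique ?_
    convert hasSum_single
      (f := fun n : ℕ => PowerSeries.coeff n (PowerSeries.X : PowerSeries (MvPowerSeries σ K)) *
        p ^ n) 1 (fun n hn => by simp [PowerSeries.coeff_X, hn])
    simp
  have h := congrArg ev (prod_mul_mk_wordSum q t n)
  simp only [map_mul, map_prod, map_sum, map_sub, map_one, map_pow, hC, hX] at h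
  have hQ : ∏ i ∈ Finset.range (n + 1), (1 - t ^ i * p) = qPoch p t (n + 1) :=
    Finset.prod_congr rfl fun i _ => by ring
  have hs := hev (PowerSeries.mk (fun k => wordSum q (fun b : Fin (k + 1) => t ^ (b : ℕ)) n))
  rw [hQ] at h
  have : permSum t q p n * (qPoch p t (n + 1))⁻¹ =
      ev (PowerSeries.mk (fun k => wordSum q (fun b : Fin (k + 1) => t ^ (b : ℕ)) n)) := by
    rw [permSum, ← h]
    linear_combination ev (PowerSeries.mk
      (fun k => wordSum q (fun b : Fin (k + 1) => t ^ (b : ℕ)) n)) * qPoch_mul_inv p t hp (n + 1)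
  rw [this]
  convert hs using 2 with k
  simp [mul_comm]

theorem hasSum_prod_qExp (t q u : MvPowerSeries σ K) (hq : MvPowerSeries.constantCoeff q = 0)
    (hu : MvPowerSeries.constantCoeff u = 0) (k : ℕ) :
    HasSum (fun n : ℕ => u ^ n *
      (wordSum q (fun b : Fin (k + 1) => t ^ (b : ℕ)) n * (qFact q n)⁻¹))
      (∏ i ∈ Finset.range (k + 1), qExp q (t ^ i * u)) := by
  obtain ⟨ev, hev⟩ := exists_evalHom u hu
  have hc := qFact_mul_inv q hq
  have he : ∀ x, ev (expSeries (fun n => (qFact q n)⁻¹) x) = qExp q (x * u) := fun x => by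
    rw [qExp, ← (hev _).tsum_eq]
    refine tsum_congr fun n => ?_
    simp only [expSeries, PowerSeries.coeff_mk]
    ring
  have hs := hev (∏ b : Fin (k + 1), expSeries (fun n => (qFact q n)⁻¹) (t ^ (b : ℕ)))
  simp only [map_prod, he] at hs
  rw [Fin.prod_univ_eq_prod_range (fun i => qExp q (t ^ i * u))] at hs
  convert hs using 2 with n
  rw [← coeff_prod_expSeries q _ hc]
  linear_combination u ^ n * PowerSeries.coeff n
    (∏ b : Fin (k + 1), expSeries (fun n => (qFact q n)⁻¹) (t ^ (b : ℕ))) * hc n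

/-- Gessel's formula for the symmetric groups. -/
theorem exists_hasSum_permSum (t q p u : MvPowerSeries σ K)
    (hq : MvPowerSeries.constantCoeff q = 0) (hp : MvPowerSeries.constantCoeff p = 0)
    (hu : MvPowerSeries.constantCoeff u = 0) :
    ∃ s, HasSum (fun n : ℕ => u ^ n * (qFact q n)⁻¹ *
        (permSum t q p n * (qPoch p t (n + 1))⁻¹)) s ∧
      HasSum (fun k : ℕ => p ^ k * ∏ i ∈ Finset.range (k + 1), qExp q (t ^ i * u)) s := by
  -- Both series are iterated sums of one summable double series: sum over `k` first, or over `n`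
  -- first.
  obtain ⟨s, hs⟩ := summable_pow_mul_pow u p hu hp fun n k =>
    wordSum q (fun b : Fin (k + 1) => t ^ (b : ℕ)) n * (qFact q n)⁻¹
  refine ⟨s, hs.prod_fiberwise fun n => ?_, ?_⟩
  · convert (hasSum_permSum t q p hp n).mul_left (u ^ n * (qFact q n)⁻¹) using 2 with k
    · rfl
    · ring
  · refine ((Equiv.prodComm ℕ ℕ).hasSum_iff.2 hs).prod_fiberwise fun k => ?_
    convert (hasSum_prod_qExp t q u hq hu k).mul_left (p ^ k) using 2 with n
    · rfl
    · simp only [Function.comp_apply, Equiv.prodComm_apply, Prod.fst_swap, Prod.snd_swap]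
      ring

end Series

/-! ### Windows of signed permutations -/

theorem entry_of_mem {n : ℕ} (β : B n) (x : PM n) (h : 0 < (x : ℤ)) :
    entry β (x : ℤ).toNat = ((β : Equiv.Perm (PM n)) x : ℤ) := by
  have hx : (((x : ℤ).toNat : ℕ) : ℤ) = x := Int.toNat_of_nonneg h.le
  rw [entry, dif_pos (by rw [hx]; exact x.2)]
  congr 3

theorem coe_apply_eq {n : ℕ} (β : B n) (x : PM n) :
    ((β : Equiv.Perm (PM n)) x : ℤ) =
      if 0 < (x : ℤ) then entry β (x : ℤ).toNat else -entry β (-(x : ℤ)).toNat := by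
  split_ifs with h
  · exact (entry_of_mem β x h).symm
  · have hx := x.2
    have hy : -(x : ℤ) ≠ 0 ∧ -(n : ℤ) ≤ -(x : ℤ) ∧ -(x : ℤ) ≤ (n : ℤ) := by omega
    have h1 := entry_of_mem β ⟨-(x : ℤ), hy⟩ (by simp only; omega)
    have h2 := β.2 x ⟨-(x : ℤ), hy⟩ rfl
    simp only at h1
    rw [h1, h2, neg_neg]

theorem entry_mul {n : ℕ} (β s : B n) (j : ℕ) (hj : j ∈ Finset.Icc 1 n) :
    entry (β * s) j =
      if 0 < entry s j then entry β (entry s j).toNat else -entry β (-entry s j).toNat := by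
  rw [Finset.mem_Icc] at hj
  have h : (j : ℤ) ≠ 0 ∧ -(n : ℤ) ≤ (j : ℤ) ∧ (j : ℤ) ≤ (n : ℤ) := by omega
  have hs : entry s j = ((s : Equiv.Perm (PM n)) ⟨j, h⟩ : ℤ) := dif_pos h
  have hb : entry (β * s) j = ((β : Equiv.Perm (PM n)) ((s : Equiv.Perm (PM n)) ⟨j, h⟩) : ℤ) :=
    dif_pos h
  rw [hb, hs, coe_apply_eq]

/-- The window of a signed permutation, indexed by `Fin n`. -/
def window {n : ℕ} (β : B n) (i : Fin n) : ℤ := entry β (i + 1)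

/-- The sequences that are windows of signed permutations. -/
def IsWindow {n : ℕ} (w : Fin n → ℤ) : Prop :=
  (∀ i, w i ≠ 0 ∧ (w i).natAbs ≤ n) ∧ Function.Injective fun i => (w i).natAbs

theorem isWindow_window {n : ℕ} (β : B n) : IsWindow (window β) := by
  have hpos : ∀ i : Fin n, ((i + 1 : ℕ) : ℤ) ≠ 0 ∧ -(n : ℤ) ≤ ((i + 1 : ℕ) : ℤ) ∧
      ((i + 1 : ℕ) : ℤ) ≤ (n : ℤ) := fun i => by have := i.2; omega
  have hw : ∀ i, window β i = ((β : Equiv.Perm (PM n)) ⟨_, hpos i⟩ : ℤ) := fun i =>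
    dif_pos (hpos i)
  refine ⟨fun i => ?_, fun i j hij => ?_⟩
  · have := ((β : Equiv.Perm (PM n)) ⟨_, hpos i⟩).2
    rw [hw]
    omega
  · simp only [hw] at hij
    rcases Int.natAbs_eq_natAbs_iff.1 hij with h | h
    · have := congrArg Subtype.val ((β : Equiv.Perm (PM n)).injective (Subtype.ext h))
      simp only at this
      exact Fin.ext (by omega)
    · have hy : -((j + 1 : ℕ) : ℤ) ≠ 0 ∧ -(n : ℤ) ≤ -((j + 1 : ℕ) : ℤ) ∧
        -((j + 1 : ℕ) : ℤ) ≤ (n : ℤ) := by have := j.2; omega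
      rw [← β.2 ⟨_, hpos j⟩ ⟨_, hy⟩ rfl] at h
      have := congrArg Subtype.val ((β : Equiv.Perm (PM n)).injective (Subtype.ext h))
      simp only at this
      omega

theorem window_injective {n : ℕ} : Function.Injective (window (n := n)) := by
  intro β γ h
  have he : ∀ j, 1 ≤ j → j ≤ n → entry β j = entry γ j := fun j h1 h2 => by
    have := congrFun h ⟨j - 1, by omega⟩
    simpa only [window, Nat.sub_add_cancel h1] using this
  refine Subtype.ext (Equiv.ext fun x => Subtype.ext ?_)
  have hx := x.2
  rw [coe_apply_eq, coe_apply_eq]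
  split_ifs with h0
  · exact he _ (by omega) (by omega)
  · rw [he _ (by omega) (by omega)]

theorem exists_window {n : ℕ} (w : Fin n → ℤ) (hw : IsWindow w) : ∃ β : B n, window β = w := by
  obtain ⟨h1, h2⟩ := hw
  have hx : ∀ x : PM n, (x : ℤ).natAbs - 1 < n := fun x => by have := x.2; omega
  -- The odd extension of `w`.
  let f : PM n → PM n := fun x =>
    ⟨if 0 < (x : ℤ) then w ⟨_, hx x⟩ else -w ⟨_, hx x⟩, by
      have := h1 ⟨_, hx x⟩
      split_ifs <;> omega⟩
  have hf : ∀ x, (f x : ℤ) = if 0 < (x : ℤ) then w ⟨_, hx x⟩ else -w ⟨_, hx x⟩ := fun x => rfl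
  have hinj : Function.Injective f := by
    intro x y hxy
    have hxy' := congrArg Subtype.val hxy
    rw [hf, hf] at hxy'
    have habs : (x : ℤ).natAbs - 1 = (y : ℤ).natAbs - 1 := by
      have : (⟨_, hx x⟩ : Fin n) = ⟨_, hx y⟩ := h2 (by
        simp only
        split_ifs at hxy' <;> omega)
      exact congrArg Fin.val this
    have hx0 := x.2
    have hy0 := y.2
    have hxw := h1 ⟨_, hx x⟩
    simp only [habs] at hxy' hxw
    apply Subtype.ext
    split_ifs at hxy' <;> omega
  let e : Equiv.Perm (PM n) := Equiv.ofBijective f (Finite.injective_iff_bijective.1 hinj)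
  have he : ∀ x, (e x : ℤ) = if 0 < (x : ℤ) then w ⟨_, hx x⟩ else -w ⟨_, hx x⟩ := fun x => rfl
  refine ⟨⟨e, fun i j hij => ?_⟩, ?_⟩
  · rw [he, he]
    have hi := i.2
    have habs : (j : ℤ).natAbs - 1 = (i : ℤ).natAbs - 1 := by omega
    simp only [habs]
    split_ifs <;> omega
  · funext i
    have hi : ((i + 1 : ℕ) : ℤ) ≠ 0 ∧ -(n : ℤ) ≤ ((i + 1 : ℕ) : ℤ) ∧ ((i + 1 : ℕ) : ℤ) ≤ (n : ℤ) := by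
      have := i.2; omega
    rw [window, entry, dif_pos hi]
    simp only
    rw [he, if_pos (by simp only; omega)]
    congr 1

/-- The absolute values of a window, shifted to `Fin n`, form a permutation. -/
theorem IsWindow.exists_perm {n : ℕ} {w : Fin n → ℤ} (hw : IsWindow w) :
    ∃ ρ : Equiv.Perm (Fin n), ∀ i, (w i).natAbs = ρ i + 1 := by
  let f : Fin n → Fin n := fun i => ⟨(w i).natAbs - 1, by have := hw.1 i; omega⟩
  have hf : Function.Injective f := fun i j hij => hw.2 (by
    have h1 := hw.1 i
    have h2 := hw.1 j
    have := congrArg Fin.val hij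
    simp only [f] at this ⊢
    omega)
  refine ⟨Equiv.ofBijective f (Finite.injective_iff_bijective.1 hf), fun i => ?_⟩
  have h1 := hw.1 i
  simp only [Equiv.ofBijective_apply, f]
  omega

theorem window_one {n : ℕ} (i : Fin n) : window (1 : B n) i = i + 1 := by
  have hi : ((i + 1 : ℕ) : ℤ) ≠ 0 ∧ -(n : ℤ) ≤ ((i + 1 : ℕ) : ℤ) ∧ ((i + 1 : ℕ) : ℤ) ≤ (n : ℤ) := by
    have := i.2; omega
  rw [window, entry, dif_pos hi]
  simp

theorem eq_one_of_strictMono {n : ℕ} (β : B n) (h : StrictMono (window β))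
    (h0 : ∀ i, 0 < window β i) : β = 1 := by
  obtain ⟨ρ, hρ⟩ := (isWindow_window β).exists_perm
  have hm : Monotone ρ := fun i j hij => by
    have h1 := h.monotone hij
    have h2 := hρ i
    have h3 := hρ j
    have h4 := h0 i
    rw [Fin.le_def]
    omega
  rw [Equiv.Perm.monotone_iff] at hm
  subst hm
  apply window_injective
  funext i
  have h2 := hρ i
  have h4 := h0 i
  rw [window_one]
  simp only [Equiv.Perm.one_apply] at h2
  omega

/-- A statistic that grows by at most one per generator bounds the length from below; if some
generator lowers it at every nonidentity element, it is attained. `P` confines the descent to a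
subset, here `D_n` inside `B_n`. -/
theorem wordLength_eq {G : Type*} [Group G] (S : Set G) (P : G → Prop) (ℓ : G → ℕ)
    (h1 : ℓ 1 = 0) (hS : ∀ g, ∀ s ∈ S, ℓ (g * s) ≤ ℓ g + 1)
    (hd : ∀ g, P g → g ≠ 1 → ∃ s ∈ S, s * s = 1 ∧ P (g * s) ∧ ℓ (g * s) < ℓ g)
    (g : G) (hg : P g) : wordLength S g = ℓ g := by
  have hle : ∀ l : List G, (∀ s ∈ l, s ∈ S) → ℓ l.prod ≤ l.length := by
    intro l
    induction l using List.reverseRecOn with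
    | nil => simp [h1]
    | append_singleton l s ih =>
      intro hl
      rw [List.prod_append, List.prod_singleton, List.length_append, List.length_singleton]
      exact (hS _ _ (hl s (by simp))).trans
        (Nat.add_le_add_right (ih fun x hx => hl x (by simp [hx])) 1)
  have hex : ∀ m g, P g → ℓ g = m → ∃ l : List G, l.length = m ∧ (∀ s ∈ l, s ∈ S) ∧
      l.prod = g := by
    intro m
    induction m using Nat.strong_induction_on with
    | _ m ih =>
      intro g hg hm
      by_cases hg1 : g = 1
      · exact ⟨[], by simp [← hm, hg1, h1], by simp, by simp [hg1]⟩
      · obtain ⟨s, hs, hss, hP, hlt⟩ := hd g hg hg1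
        obtain ⟨l, hl, hlS, hlp⟩ := ih _ (hm ▸ hlt) (g * s) hP rfl
        -- Since `g * s * s = g`, the drop is exactly one.
        have h2 := hS (g * s) s hs
        rw [mul_assoc, hss, mul_one] at h2
        refine ⟨l ++ [s], by simp; omega, ?_, by simp [hlp, mul_assoc, hss]⟩
        intro x hx
        rcases List.mem_append.1 hx with h | h
        · exact hlS x h
        · rw [List.mem_singleton.1 h]; exact hs
  apply le_antisymm
  · exact Nat.sInf_le (hex _ g hg rfl)
  · refine le_csInf ⟨_, hex _ g hg rfl⟩ ?_
    rintro m ⟨l, rfl, hl, rfl⟩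
    exact hle l hl

/-! ### Pair statistics under the generators -/

/-- The indicator of a proposition. -/
noncomputable def indicator (P : Prop) : ℕ := open Classical in if P then 1 else 0

theorem ite_eq_indicator (P : Prop) [Decidable P] : (if P then 1 else 0) = indicator P := by
  unfold indicator
  congr

/-- The number of pairs of positions with negative sum. -/
def negPairs {n : ℕ} (w : Fin n → ℤ) : ℕ := ∑ i, ∑ j, if i < j ∧ w i + w j < 0 then 1 else 0

/-- The number of negative entries. -/
def negCount {n : ℕ} (w : Fin n → ℤ) : ℕ := ∑ i, if w i < 0 then 1 else 0

/-- An adjacent swap changes the relative order of no pair but the swapped one. The relation `r` is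
general in order to cover inversions and negative sums alike. -/
theorem sum_pairs_comp_swap {n : ℕ} (r : ℤ → ℤ → Prop) [DecidableRel r] (w : Fin n → ℤ) (i : ℕ)
    (h : i + 1 < n) :
    (∑ a, ∑ b, if a < b ∧ r ((w ∘ Equiv.swap ⟨i, by omega⟩ ⟨i + 1, h⟩) a)
        ((w ∘ Equiv.swap ⟨i, by omega⟩ ⟨i + 1, h⟩) b) then 1 else 0) +
      (if r (w ⟨i, by omega⟩) (w ⟨i + 1, h⟩) then 1 else 0) =
    (∑ a, ∑ b, if a < b ∧ r (w a) (w b) then 1 else 0) +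
      (if r (w ⟨i + 1, h⟩) (w ⟨i, by omega⟩) then 1 else 0) := by
  set x : Fin n := ⟨i, by omega⟩ with hx
  set y : Fin n := ⟨i + 1, h⟩ with hy
  have hxy : x ≠ y := by simp [hx, hy]
  have hd : ∀ (u v : Fin n) , (if r (w u) (w v) then 1 else 0) =
      ∑ a, ∑ b, if a = u ∧ b = v ∧ r (w a) (w b) then 1 else 0 := by
    intro u v
    rw [Finset.sum_eq_single u (fun a _ ha => by simp [ha]) (by simp),
      Finset.sum_eq_single v (fun b _ hb => by simp [hb]) (by simp)]
    simp
  rw [hd x y, hd y x, ← Equiv.sum_comp (Equiv.swap x y), ← Finset.sum_add_distrib,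
    ← Finset.sum_add_distrib]
  refine Finset.sum_congr rfl fun a _ => ?_
  rw [← Equiv.sum_comp (Equiv.swap x y), ← Finset.sum_add_distrib, ← Finset.sum_add_distrib]
  refine Finset.sum_congr rfl fun b _ => ?_
  simp only [Function.comp_apply, Equiv.swap_apply_self]
  have hlt : x < y := by simp [hx, hy]
  have hxv : (x : ℕ) = i := rfl
  have hyv : (y : ℕ) = i + 1 := rfl
  by_cases hr : r (w a) (w b)
  · simp only [hr, and_true]
    rcases eq_or_ne a x with rfl | hax
    · rcases eq_or_ne b y with rfl | hby
      · simp [hlt, hlt.not_gt, hxy, hxy.symm]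
      · rcases eq_or_ne b x with rfl | hbx
        · simp [hxy]
        · rw [Equiv.swap_apply_left, Equiv.swap_apply_of_ne_of_ne hbx hby]
          have : y < b ↔ x < b := by
            have h1 : (b : ℕ) ≠ y := fun h => hby (Fin.ext h)
            simp only [Fin.lt_def]; omega
          simp [this, hby, hxy]
    · rcases eq_or_ne a y with rfl | hay
      · rcases eq_or_ne b x with rfl | hbx
        · simp [hlt, hlt.not_gt, hxy, hxy.symm]
        · rcases eq_or_ne b y with rfl | hby
          · simp [hxy.symm]
          · rw [Equiv.swap_apply_right, Equiv.swap_apply_of_ne_of_ne hbx hby]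
            have : x < b ↔ y < b := by
              have h1 : (b : ℕ) ≠ y := fun h => hby (Fin.ext h)
              simp only [Fin.lt_def]; omega
            simp [this, hbx, hxy.symm]
      · rw [Equiv.swap_apply_of_ne_of_ne hax hay]
        have ha1 : (a : ℕ) ≠ x := fun h => hax (Fin.ext h)
        have ha2 : (a : ℕ) ≠ y := fun h => hay (Fin.ext h)
        have : a < Equiv.swap x y b ↔ a < b := by
          rcases eq_or_ne b x with rfl | hbx
          · rw [Equiv.swap_apply_left]; simp only [Fin.lt_def]; omega
          · rcases eq_or_ne b y with rfl | hby
            · rw [Equiv.swap_apply_right]; simp only [Fin.lt_def]; omega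
            · rw [Equiv.swap_apply_of_ne_of_ne hbx hby]
        simp [this, hax, hay]
  · simp [hr]

theorem inversions_comp_swap {n : ℕ} (w : Fin n → ℤ) (i : ℕ) (h : i + 1 < n) :
    inversions (w ∘ Equiv.swap ⟨i, by omega⟩ ⟨i + 1, h⟩) +
      (if w ⟨i + 1, h⟩ < w ⟨i, by omega⟩ then 1 else 0) =
    inversions w + (if w ⟨i, by omega⟩ < w ⟨i + 1, h⟩ then 1 else 0) :=
  sum_pairs_comp_swap (fun x y => y < x) w i h

theorem negPairs_comp_swap {n : ℕ} (w : Fin n → ℤ) (i : ℕ) (h : i + 1 < n) :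
    negPairs (w ∘ Equiv.swap ⟨i, by omega⟩ ⟨i + 1, h⟩) = negPairs w := by
  have := sum_pairs_comp_swap (fun x y => x + y < 0) w i h
  simp only [add_comm (w ⟨i + 1, h⟩)] at this
  exact Nat.add_right_cancel this

theorem negCount_comp_perm {n : ℕ} (w : Fin n → ℤ) (π : Equiv.Perm (Fin n)) :
    negCount (w ∘ π) = negCount w :=
  Equiv.sum_comp π fun i => if w i < 0 then 1 else 0

theorem inversions_succ {n : ℕ} (w : Fin (n + 1) → ℤ) :
    inversions w = (∑ j : Fin n, if w j.succ < w 0 then 1 else 0) +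
      inversions fun j : Fin n => w j.succ := by
  simp only [inversions, Fin.sum_univ_succ, Fin.succ_lt_succ_iff, Fin.succ_pos,
    Fin.not_lt_zero, true_and, false_and, if_false, zero_add]

theorem negPairs_succ {n : ℕ} (w : Fin (n + 1) → ℤ) :
    negPairs w = (∑ j : Fin n, if w 0 + w j.succ < 0 then 1 else 0) +
      negPairs fun j : Fin n => w j.succ := by
  simp only [negPairs, Fin.sum_univ_succ, Fin.succ_lt_succ_iff, Fin.succ_pos,
    Fin.not_lt_zero, true_and, false_and, if_false, zero_add]

theorem negCount_succ {n : ℕ} (w : Fin (n + 1) → ℤ) :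
    negCount w = (if w 0 < 0 then 1 else 0) + negCount fun j : Fin n => w j.succ := by
  simp only [negCount, Fin.sum_univ_succ]

/-- The effect on windows of right multiplication by `s_0^B`. -/
def flipB {n : ℕ} (w : Fin (n + 1) → ℤ) : Fin (n + 1) → ℤ := Fin.cons (-w 0) fun j => w j.succ

/-- The effect on windows of right multiplication by `s_0^D`. -/
def flipD {n : ℕ} (w : Fin (n + 2) → ℤ) : Fin (n + 2) → ℤ :=
  Fin.cons (-w 1) (Fin.cons (-w 0) fun j : Fin n => w j.succ.succ)

/-- Negating `w 0` exchanges the conditions `w j < w 0` and `w 0 + w j < 0`. -/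
theorem inversions_add_negPairs_flipB {n : ℕ} (w : Fin (n + 1) → ℤ) :
    inversions (flipB w) + negPairs (flipB w) = inversions w + negPairs w := by
  simp only [inversions_succ, negPairs_succ, flipB, Fin.cons_zero, Fin.cons_succ]
  have h1 : ∀ j : Fin n, (-w 0 + w j.succ < 0) ↔ w j.succ < w 0 := fun j => by omega
  have h2 : ∀ j : Fin n, (w 0 + w j.succ < 0) ↔ w j.succ < -w 0 := fun j => by omega
  simp only [h1, h2]
  omega

theorem negCount_flipB {n : ℕ} (w : Fin (n + 1) → ℤ) :
    negCount (flipB w) + (if w 0 < 0 then 1 else 0) =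
      negCount w + (if 0 < w 0 then 1 else 0) := by
  simp only [negCount_succ, flipB, Fin.cons_zero, Fin.cons_succ]
  split_ifs <;> omega

theorem inversions_succ_succ {n : ℕ} (w : Fin (n + 2) → ℤ) :
    inversions w = (indicator (w 1 < w 0) + ∑ j : Fin n, indicator (w j.succ.succ < w 0)) +
      ((∑ j : Fin n, indicator (w j.succ.succ < w 1)) +
        inversions fun j : Fin n => w j.succ.succ) := by
  rw [inversions_succ, inversions_succ, Fin.sum_univ_succ]
  simp only [ite_eq_indicator]
  rfl

theorem negPairs_succ_succ {n : ℕ} (w : Fin (n + 2) → ℤ) :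
    negPairs w =
      (indicator (w 0 + w 1 < 0) + ∑ j : Fin n, indicator (w 0 + w j.succ.succ < 0)) +
      ((∑ j : Fin n, indicator (w 1 + w j.succ.succ < 0)) +
        negPairs fun j : Fin n => w j.succ.succ) := by
  rw [negPairs_succ, negPairs_succ, Fin.sum_univ_succ]
  simp only [ite_eq_indicator]
  rfl

theorem negCount_succ_succ {n : ℕ} (w : Fin (n + 2) → ℤ) :
    negCount w = indicator (w 0 < 0) +
      (indicator (w 1 < 0) + negCount fun j : Fin n => w j.succ.succ) := by
  rw [negCount_succ, negCount_succ]
  simp only [ite_eq_indicator]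
  rfl

/-- Against later entries, inversions and negative sums trade places as in type B. Within the first
pair the inversion is unaffected and only the sign of the sum flips. -/
theorem inversions_add_negPairs_flipD {n : ℕ} (w : Fin (n + 2) → ℤ) :
    inversions (flipD w) + negPairs (flipD w) + indicator (w 0 + w 1 < 0) =
      inversions w + negPairs w + indicator (0 < w 0 + w 1) := by
  have e0 : flipD w 0 = -w 1 := rfl
  have e1 : flipD w 1 = -w 0 := rfl
  have e2 : ∀ j : Fin n, flipD w j.succ.succ = w j.succ.succ := fun j => rfl
  simp only [inversions_succ_succ, negPairs_succ_succ, e0, e1, e2]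
  have h1 : ∀ j : Fin n, (-w 0 + w j.succ.succ < 0) ↔ w j.succ.succ < w 0 := fun j => by omega
  have h2 : ∀ j : Fin n, (w 0 + w j.succ.succ < 0) ↔ w j.succ.succ < -w 0 := fun j => by omega
  have h3 : ∀ j : Fin n, (-w 1 + w j.succ.succ < 0) ↔ w j.succ.succ < w 1 := fun j => by omega
  have h4 : ∀ j : Fin n, (w 1 + w j.succ.succ < 0) ↔ w j.succ.succ < -w 1 := fun j => by omega
  have h5 : -w 0 < -w 1 ↔ w 1 < w 0 := by omega
  have h6 : -w 1 + -w 0 < 0 ↔ 0 < w 0 + w 1 := by omega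
  simp only [h1, h2, h3, h4, h5, h6]
  omega

theorem even_negCount_flipD {n : ℕ} (w : Fin (n + 2) → ℤ) (h0 : w 0 ≠ 0) (h1 : w 1 ≠ 0) :
    Even (negCount (flipD w)) ↔ Even (negCount w) := by
  have e0 : flipD w 0 = -w 1 := rfl
  have e1 : flipD w 1 = -w 0 := rfl
  have e2 : ∀ j : Fin n, flipD w j.succ.succ = w j.succ.succ := fun j => rfl
  simp only [negCount_succ_succ, e0, e1, e2, indicator]
  split_ifs <;> first | omega | (simp only [Nat.even_iff] <;> omega)

/-! ### Generators acting on windows, and the two length functions -/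

theorem entry_eq_window {n : ℕ} (β : B n) (j : ℕ) (h1 : 1 ≤ j) (h2 : j ≤ n) :
    entry β j = window β ⟨j - 1, by omega⟩ := by
  rw [window]
  simp only [Nat.sub_add_cancel h1]

theorem window_mul {n : ℕ} (β s : B n) (i : Fin n) :
    window (β * s) i =
      if 0 < window s i then entry β (window s i).toNat else -entry β (-window s i).toNat :=
  entry_mul β s _ (by have := i.2; rw [Finset.mem_Icc]; omega)

theorem hasWindow_iff {n : ℕ} (s : B n) (f : ℕ → ℤ) :
    HasWindow s f ↔ ∀ i : Fin n, window s i = f (i + 1) := by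
  constructor
  · intro h i
    exact h _ (by have := i.2; rw [Finset.mem_Icc]; omega)
  · intro h j hj
    rw [Finset.mem_Icc] at hj
    rw [entry_eq_window s j hj.1 hj.2, h]
    simp only [Nat.sub_add_cancel hj.1]

theorem window_mul_adjacent {n : ℕ} (i : ℕ) (hi : i + 1 < n) (s : B n)
    (hs : ∀ j : Fin n, window s j =
      if (j : ℕ) + 1 = i + 1 then ((i + 1 : ℕ) : ℤ) + 1 else
        if (j : ℕ) + 1 = i + 1 + 1 then ((i + 1 : ℕ) : ℤ) else ((j + 1 : ℕ) : ℤ)) (β : B n) :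
    window (β * s) = window β ∘ Equiv.swap ⟨i, by omega⟩ ⟨i + 1, hi⟩ := by
  funext j
  have hj := j.2
  rw [window_mul, Function.comp_apply]
  rcases eq_or_ne (j : ℕ) i with h | h
  · have : j = ⟨i, by omega⟩ := Fin.ext h
    have hw : window s j = ((i + 2 : ℕ) : ℤ) := by rw [hs, if_pos (by omega)]; push_cast; ring
    rw [hw, if_pos (by omega), this, Equiv.swap_apply_left, Int.toNat_natCast]
    rfl
  · rcases eq_or_ne (j : ℕ) (i + 1) with h' | h'
    · have : j = ⟨i + 1, hi⟩ := Fin.ext h'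
      have hw : window s j = ((i + 1 : ℕ) : ℤ) := by
        rw [hs, if_neg (by omega), if_pos (by omega)]
      rw [hw, if_pos (by omega), this, Equiv.swap_apply_right, Int.toNat_natCast]
      rfl
    · have hw : window s j = ((j + 1 : ℕ) : ℤ) := by
        rw [hs, if_neg (by omega), if_neg (by omega)]
      rw [hw, if_pos (by omega), Int.toNat_natCast, Equiv.swap_apply_of_ne_of_ne
        (fun h0 => h (congrArg Fin.val h0)) (fun h0 => h' (congrArg Fin.val h0))]
      rfl

theorem window_mul_of_mem_adjacentGens {n : ℕ} {s : B n} (hs : s ∈ adjacentGens n) :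
    ∃ (i : ℕ) (hi : i + 1 < n), ∀ β : B n,
      window (β * s) = window β ∘ Equiv.swap ⟨i, by omega⟩ ⟨i + 1, hi⟩ := by
  obtain ⟨i, h1, h2, h⟩ := hs
  rw [hasWindow_iff] at h
  obtain ⟨i, rfl⟩ : ∃ k, i = k + 1 := ⟨i - 1, by omega⟩
  exact ⟨i, by omega, window_mul_adjacent i (by omega) s h⟩

theorem exists_mem_adjacentGens {n : ℕ} (i : ℕ) (hi : i + 1 < n) :
    ∃ s ∈ adjacentGens n, s * s = 1 ∧ ∀ β : B n,
      window (β * s) = window β ∘ Equiv.swap ⟨i, by omega⟩ ⟨i + 1, hi⟩ := by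
  obtain ⟨s, hs⟩ := exists_window (n := n) (fun j =>
      if (j : ℕ) + 1 = i + 1 then ((i + 1 : ℕ) : ℤ) + 1 else
        if (j : ℕ) + 1 = i + 1 + 1 then ((i + 1 : ℕ) : ℤ) else ((j + 1 : ℕ) : ℤ)) (by
    constructor
    · intro j
      have := j.2
      simp only
      split_ifs <;> omega
    · intro j k hjk
      have := j.2
      have := k.2
      apply Fin.ext
      simp only at hjk
      split_ifs at hjk <;> omega)
  have hw := window_mul_adjacent i hi s (congrFun hs)
  refine ⟨s, ⟨i + 1, by omega, by omega, (hasWindow_iff _ _).2 (congrFun hs)⟩, ?_, hw⟩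
  apply window_injective
  have h1 := hw 1
  rw [one_mul] at h1
  rw [hw, h1]
  funext j
  simp

theorem window_mul_flipB {n : ℕ} (s : B (n + 1))
    (hs : ∀ j : Fin (n + 1), window s j = if (j : ℕ) + 1 = 1 then -1 else ((j + 1 : ℕ) : ℤ))
    (β : B (n + 1)) : window (β * s) = flipB (window β) := by
  funext j
  refine Fin.cases ?_ (fun j => ?_) j
  · rw [window_mul, hs]
    rfl
  · have h := hs j.succ
    rw [if_neg (by simp)] at h
    rw [window_mul, h, if_pos (by omega), Int.toNat_natCast]
    rfl

theorem flipB_flipB {n : ℕ} (w : Fin (n + 1) → ℤ) : flipB (flipB w) = w := by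
  funext j
  refine Fin.cases ?_ (fun j => ?_) j
  · simp [flipB]
  · rfl

theorem exists_gensB_flipB (n : ℕ) :
    ∃ s ∈ gensB (n + 1), s * s = 1 ∧ ∀ β : B (n + 1), window (β * s) = flipB (window β) := by
  obtain ⟨s, hs⟩ := exists_window (n := n + 1)
    (fun j => if (j : ℕ) + 1 = 1 then -1 else ((j + 1 : ℕ) : ℤ)) (by
    constructor
    · intro j
      have := j.2
      simp only
      split_ifs <;> omega
    · intro j k hjk
      apply Fin.ext
      simp only at hjk
      split_ifs at hjk <;> omega)
  have hw := window_mul_flipB s (congrFun hs)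
  refine ⟨s, Or.inr ⟨by omega, (hasWindow_iff _ _).2 (congrFun hs)⟩, ?_, hw⟩
  apply window_injective
  have h1 := hw 1
  rw [one_mul] at h1
  rw [hw, h1, flipB_flipB]

theorem window_mul_flipD {n : ℕ} (s : B (n + 2))
    (hs : ∀ j : Fin (n + 2), window s j =
      if (j : ℕ) + 1 = 1 then -2 else if (j : ℕ) + 1 = 2 then -1 else ((j + 1 : ℕ) : ℤ))
    (β : B (n + 2)) : window (β * s) = flipD (window β) := by
  funext j
  refine Fin.cases ?_ (fun j => Fin.cases ?_ (fun j => ?_) j) j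
  · rw [window_mul, hs]
    rfl
  · rw [window_mul, hs]
    rfl
  · have h := hs j.succ.succ
    rw [if_neg (by simp), if_neg (by simp)] at h
    rw [window_mul, h, if_pos (by omega), Int.toNat_natCast]
    rfl

theorem flipD_flipD {n : ℕ} (w : Fin (n + 2) → ℤ) : flipD (flipD w) = w := by
  funext j
  refine Fin.cases ?_ (fun j => Fin.cases ?_ (fun j => ?_) j) j
  · exact neg_neg (w 0)
  · exact neg_neg (w 1)
  · rfl

theorem exists_gensD_flipD (n : ℕ) :
    ∃ s ∈ gensD (n + 2), s * s = 1 ∧ ∀ β : B (n + 2), window (β * s) = flipD (window β) := by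
  obtain ⟨s, hs⟩ := exists_window (n := n + 2) (fun j =>
    if (j : ℕ) + 1 = 1 then -2 else if (j : ℕ) + 1 = 2 then -1 else ((j + 1 : ℕ) : ℤ)) (by
    constructor
    · intro j
      have := j.2
      simp only
      split_ifs <;> omega
    · intro j k hjk
      apply Fin.ext
      simp only at hjk
      split_ifs at hjk <;> omega)
  have hw := window_mul_flipD s (congrFun hs)
  refine ⟨s, Or.inr ⟨by omega, (hasWindow_iff _ _).2 (congrFun hs)⟩, ?_, hw⟩
  apply window_injective
  have h1 := hw 1
  rw [one_mul] at h1
  rw [hw, h1, flipD_flipD]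

theorem inversions_comp_swap_le {n : ℕ} (w : Fin n → ℤ) (i : ℕ) (h : i + 1 < n) :
    inversions (w ∘ Equiv.swap ⟨i, by omega⟩ ⟨i + 1, h⟩) ≤ inversions w + 1 := by
  have := inversions_comp_swap w i h
  split_ifs at this <;> omega

theorem window_one_stats (n : ℕ) : inversions (window (1 : B n)) = 0 ∧
    negPairs (window (1 : B n)) = 0 ∧ negCount (window (1 : B n)) = 0 := by
  simp only [inversions, negPairs, negCount, window_one]
  refine ⟨?_, ?_, ?_⟩
  · refine Finset.sum_eq_zero fun i _ => Finset.sum_eq_zero fun j _ => if_neg ?_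
    rw [Fin.lt_def]
    omega
  · refine Finset.sum_eq_zero fun i _ => Finset.sum_eq_zero fun j _ => if_neg ?_
    omega
  · refine Finset.sum_eq_zero fun i _ => if_neg ?_
    omega

/-- Away from the windows that increase, some adjacent transposition lowers the length. -/
theorem exists_adjacent_descent {n : ℕ} (β : B n) (h : ¬ StrictMono (window β)) :
    ∃ s ∈ adjacentGens n, s * s = 1 ∧ inversions (window (β * s)) < inversions (window β) ∧
      negPairs (window (β * s)) = negPairs (window β) ∧
      negCount (window (β * s)) = negCount (window β) := by
  cases n with
  | zero => exact absurd (fun i => i.elim0) h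
  | succ n =>
    rw [Fin.strictMono_iff_lt_succ] at h
    push Not at h
    obtain ⟨i, hi⟩ := h
    obtain ⟨s, hs, hss, hw⟩ := exists_mem_adjacentGens (n := n + 1) i (by omega)
    refine ⟨s, hs, hss, ?_, ?_, ?_⟩
    · have h1 := inversions_comp_swap (window β) i (by omega)
      rw [hw]
      have h2 : window β ⟨i + 1, by omega⟩ < window β ⟨i, by omega⟩ := by
        refine lt_of_le_of_ne hi fun he => ?_
        have := (isWindow_window β).2 (congrArg Int.natAbs he)
        simp [Fin.ext_iff] at this
      rw [if_pos h2, if_neg h2.not_gt] at h1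
      omega
    · rw [hw, negPairs_comp_swap]
    · rw [hw, negCount_comp_perm]

theorem lengthB_eq {n : ℕ} (β : B n) :
    lengthB β = inversions (window β) + negPairs (window β) + negCount (window β) := by
  refine wordLength_eq (gensB n) (fun _ => True)
    (fun β => inversions (window β) + negPairs (window β) + negCount (window β))
    ?_ ?_ ?_ β trivial
  · obtain ⟨h1, h2, h3⟩ := window_one_stats n
    simp only [h1, h2, h3]
  · rintro β s (hs | ⟨hn, hs⟩)
    · obtain ⟨i, hi, hw⟩ := window_mul_of_mem_adjacentGens hs
      have := inversions_comp_swap_le (window β) i hi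
      simp only [hw, negPairs_comp_swap, negCount_comp_perm]
      omega
    · obtain ⟨n, rfl⟩ : ∃ m, n = m + 1 := ⟨n - 1, by omega⟩
      rw [hasWindow_iff] at hs
      simp only [window_mul_flipB s hs, inversions_add_negPairs_flipB]
      have := negCount_flipB (window β)
      split_ifs at this <;> omega
  · intro β _ hβ
    by_cases hm : StrictMono (window β)
    · cases n with
      | zero => exact absurd (eq_one_of_strictMono β hm fun i => i.elim0) hβ
      | succ n =>
        obtain ⟨s, hs, hss, hw⟩ := exists_gensB_flipB n
        refine ⟨s, hs, hss, trivial, ?_⟩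
        simp only [hw, inversions_add_negPairs_flipB]
        have h1 := negCount_flipB (window β)
        -- An increasing window with positive first entry is the identity.
        have h2 : window β 0 < 0 := by
          by_contra h
          refine hβ (eq_one_of_strictMono β hm fun i => ?_)
          have h3 := ((isWindow_window β).1 0).1
          have h4 := hm.monotone (Fin.zero_le i)
          omega
        rw [if_pos h2, if_neg h2.not_gt] at h1
        omega
    · obtain ⟨s, hs, hss, h1, h2, h3⟩ := exists_adjacent_descent β hm
      exact ⟨s, Or.inl hs, hss, trivial, by omega⟩

theorem lengthD_eq {n : ℕ} (β : B n) (h : Even (negCount (window β))) :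
    lengthD β = inversions (window β) + negPairs (window β) := by
  refine wordLength_eq (gensD n) (fun β => Even (negCount (window β)))
    (fun β => inversions (window β) + negPairs (window β)) ?_ ?_ ?_ β h
  · obtain ⟨h1, h2, h3⟩ := window_one_stats n
    simp only [h1, h2]
  · rintro β s (hs | ⟨hn, hs⟩)
    · obtain ⟨i, hi, hw⟩ := window_mul_of_mem_adjacentGens hs
      have := inversions_comp_swap_le (window β) i hi
      simp only [hw, negPairs_comp_swap]
      omega
    · obtain ⟨n, rfl⟩ : ∃ m, n = m + 2 := ⟨n - 2, by omega⟩
      rw [hasWindow_iff] at hs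
      simp only [window_mul_flipD s hs]
      have := inversions_add_negPairs_flipD (window β)
      unfold indicator at this
      split_ifs at this <;> omega
  · intro β he hβ
    by_cases hm : StrictMono (window β)
    · match n, β, he, hβ, hm with
      | 0, β, he, hβ, hm => exact absurd (eq_one_of_strictMono β hm fun i => i.elim0) hβ
      -- There are no generators here; parity alone forces the identity.
      | 1, β, he, hβ, hm =>
        refine absurd (eq_one_of_strictMono β hm fun i => ?_) hβ
        have h3 := ((isWindow_window β).1 0).1
        obtain rfl := Subsingleton.elim i 0
        by_contra hc
        have h4 : window β 0 < 0 := by omega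
        rw [negCount, Fin.sum_univ_one, if_pos h4] at he
        exact absurd he (by decide)
      | n + 2, β, he, hβ, hm =>
        obtain ⟨s, hs, hss, hw⟩ := exists_gensD_flipD n
        refine ⟨s, hs, hss, ?_, ?_⟩
        · rw [hw]
          exact (even_negCount_flipD _ ((isWindow_window β).1 0).1
            ((isWindow_window β).1 1).1).2 he
        · simp only [hw]
          have h1 := inversions_add_negPairs_flipD (window β)
          have h01 : window β 0 < window β 1 := hm (by simp)
          -- Otherwise `window β 1` and all later entries are positive, and evenness forbids `window
          -- β 0` to be the only negative entry.
          have h2 : window β 0 + window β 1 < 0 := by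
            by_contra h
            refine hβ (eq_one_of_strictMono β hm fun i => ?_)
            have h3 : ∀ j : Fin n, 0 < window β j.succ.succ := fun j => by
              have : window β 1 < window β j.succ.succ := hm (by
                rw [Fin.lt_def]; simp)
              omega
            have h4 : (negCount fun j : Fin n => window β j.succ.succ) = 0 :=
              Finset.sum_eq_zero fun j _ => if_neg (h3 j).not_gt
            rw [negCount_succ_succ, h4] at he
            have h0 := ((isWindow_window β).1 0).1
            have h5 : 0 < window β 0 := by
              by_contra hc
              have h6 : window β 0 < 0 := by omega
              have h7 : ¬ window β 1 < 0 := by omega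
              simp [indicator, h6, h7] at he
            have h6 := hm.monotone (Fin.zero_le i)
            omega
          have h3 : ¬ 0 < window β 0 + window β 1 := by omega
          simp only [indicator, h2, h3, if_true, if_false] at h1
          omega
    · obtain ⟨s, hs, hss, h1, h2, h3⟩ := exists_adjacent_descent β hm
      exact ⟨s, Or.inl hs, hss, by rwa [h3], by omega⟩

/-! ### Statistics in terms of the negative set -/

/-- The set of the `|wᵢ| - 1` for the negative entries `wᵢ`. -/
def negSet {n : ℕ} (w : Fin n → ℤ) : Finset ℕ :=
  ({i | w i < 0} : Finset (Fin n)).image fun i => (w i).natAbs - 1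

theorem sum_negSet {n : ℕ} {w : Fin n → ℤ} (hw : IsWindow w) (f : ℕ → ℕ) :
    ∑ a ∈ negSet w, f a = ∑ i, if w i < 0 then f ((w i).natAbs - 1) else 0 := by
  rw [negSet, Finset.sum_image, Finset.sum_filter]
  intro i _ j _ hij
  apply hw.2
  have h1 := hw.1 i
  have h2 := hw.1 j
  simp only at hij ⊢
  omega

theorem negSet_subset {n : ℕ} {w : Fin n → ℤ} (hw : IsWindow w) : negSet w ⊆ Finset.range n := by
  intro a ha
  obtain ⟨i, _, rfl⟩ := Finset.mem_image.1 ha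
  have := hw.1 i
  rw [Finset.mem_range]
  omega

theorem mem_negSet_iff {n : ℕ} {w : Fin n → ℤ} (hw : IsWindow w) (i : Fin n) :
    (w i).natAbs - 1 ∈ negSet w ↔ w i < 0 := by
  rw [negSet, Finset.mem_image]
  constructor
  · rintro ⟨j, hj, hij⟩
    have h1 := hw.1 i
    have h2 := hw.1 j
    have : j = i := hw.2 (by simp only; omega)
    rw [← this]
    exact (Finset.mem_filter.1 hj).2
  · intro h
    exact ⟨i, by simpa using h, rfl⟩

theorem card_natAbs_lt {n : ℕ} {w : Fin n → ℤ} (hw : IsWindow w) (i : Fin n) :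
    (∑ j, if (w j).natAbs < (w i).natAbs then 1 else 0) = (w i).natAbs - 1 := by
  obtain ⟨ρ, hρ⟩ := hw.exists_perm
  simp only [hρ, Nat.add_lt_add_iff_right, Fin.val_fin_lt]
  rw [Equiv.sum_comp ρ (fun j => if j < ρ i then 1 else 0), Finset.sum_boole]
  simp [Finset.filter_gt_eq_Iio]

/-- A pair has negative sum exactly when its entry of larger absolute value is negative. Charged to
that entry, a negative entry of absolute value `a + 1` accounts for `a` pairs. -/
theorem negPairs_eq {n : ℕ} {w : Fin n → ℤ} (hw : IsWindow w) :
    negPairs w = ∑ a ∈ negSet w, a := by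
  have hsplit : ∀ i j : Fin n, (if i < j ∧ w i + w j < 0 then 1 else 0) =
      (if i < j ∧ w i < 0 ∧ (w j).natAbs < (w i).natAbs then 1 else 0) +
      (if i < j ∧ w j < 0 ∧ (w i).natAbs < (w j).natAbs then 1 else 0) := by
    intro i j
    by_cases hij : i < j
    · have h1 : (w i).natAbs ≠ (w j).natAbs := fun h => hij.ne (hw.2 h)
      have h2 := hw.1 i
      have h3 := hw.1 j
      simp only [hij, true_and]
      split_ifs <;> omega
    · simp [hij]
  have hmerge : ∀ i j : Fin n,
      (if i < j ∧ w i < 0 ∧ (w j).natAbs < (w i).natAbs then 1 else 0) +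
      (if j < i ∧ w i < 0 ∧ (w j).natAbs < (w i).natAbs then 1 else 0) =
      if w i < 0 then (if (w j).natAbs < (w i).natAbs then 1 else 0) else 0 := by
    intro i j
    rcases lt_trichotomy i j with h | rfl | h
    · simp only [h, h.not_gt, true_and, false_and, if_false, add_zero, ite_and]
    · simp
    · simp only [h, h.not_gt, true_and, false_and, if_false, zero_add, ite_and]
  rw [negPairs, sum_negSet hw fun a => a]
  simp only [hsplit, Finset.sum_add_distrib]
  conv_lhs => rw [Finset.sum_comm (γ := Fin n) (f := fun i j =>
    if i < j ∧ w j < 0 ∧ (w i).natAbs < (w j).natAbs then 1 else 0)]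
  simp only [← Finset.sum_add_distrib, hmerge]
  refine Finset.sum_congr rfl fun i _ => ?_
  split_ifs
  · exact card_natAbs_lt hw i
  · simp

theorem negCount_eq {n : ℕ} {w : Fin n → ℤ} (hw : IsWindow w) :
    negCount w = (negSet w).card := by
  rw [Finset.card_eq_sum_ones, sum_negSet hw, negCount]

theorem sum_Icc_entry {n : ℕ} (β : B n) (f : ℤ → ℕ) :
    ∑ i ∈ Finset.Icc 1 n, f (entry β i) = ∑ i, f (window β i) := by
  unfold window
  rw [Fin.sum_univ_eq_sum_range (fun i => f (entry β (i + 1))), Finset.range_eq_Ico,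
    Finset.sum_Ico_add' (fun i => f (entry β i)) 0 n 1, zero_add]
  rfl

theorem sum_negPos {n : ℕ} (β : B n) (f : ℤ → ℕ) :
    ∑ i ∈ negPos β, f (entry β i) = ∑ i, if window β i < 0 then f (window β i) else 0 := by
  rw [negPos, Finset.sum_filter, sum_Icc_entry β fun x => if x < 0 then f x else 0]

theorem card_negPos {n : ℕ} (β : B n) : (negPos β).card = (negSet (window β)).card := by
  rw [← negCount_eq (isWindow_window β), Finset.card_eq_sum_ones, sum_negPos β fun _ => 1]
  rfl

theorem sum_des {n : ℕ} (β : B n) (f : ℕ → ℕ) :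
    ∑ i ∈ des β, f i = ∑ i ∈ Finset.range (n + 1), f i * descentInd (window β) i := by
  classical
  simp only [descentInd, mul_ite, mul_one, mul_zero]
  rw [← Finset.sum_filter]
  refine Finset.sum_congr ?_ fun _ _ => rfl
  ext i
  simp only [des, Finset.mem_filter, Finset.mem_Icc, Finset.mem_range]
  constructor
  · rintro ⟨⟨h1, h2⟩, h3⟩
    refine ⟨by omega, by omega, by omega, ?_⟩
    rw [entry_eq_window β i h1 (by omega)] at h3
    exact h3
  · rintro ⟨_, h2, h3, h4⟩
    refine ⟨⟨by omega, by omega⟩, ?_⟩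
    rw [entry_eq_window β i h3 (by omega)]
    exact h4

theorem sum_card_filter_ne_zero (s : Multiset ℕ) : (s.filter (· ≠ 0)).sum = s.sum ∧
    (s.filter (· ≠ 0)).card = (s.map fun x => if x = 0 then 0 else 1).sum := by
  induction s using Multiset.induction_on with
  | empty => simp
  | cons a s ih =>
    by_cases h : a = 0
    · simp [h] at ih ⊢
      exact ih
    · simp [h] at ih ⊢
      omega

theorem nmaj_eq {n : ℕ} (β : B n) : nmaj β =
    (∑ i ∈ Finset.range (n + 1), i * descentInd (window β) i) +
      ∑ a ∈ negSet (window β), (a + 1) := by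
  have hw := isWindow_window β
  have h1 : nmaj β = ∑ i ∈ des β, i + ∑ i ∈ negPos β, (-entry β i).toNat := by
    rw [nmaj, NDes, Multiset.sum_add, ← Finset.sum_eq_multiset_sum, Finset.sum]
    simp
  rw [h1, sum_des β fun i => i, sum_negPos β fun x => (-x).toNat, sum_negSet hw]
  congr 1
  refine Finset.sum_congr rfl fun i _ => ?_
  have := hw.1 i
  split_ifs <;> omega

theorem ndes_eq {n : ℕ} (β : B n) : ndes β =
    (∑ i ∈ Finset.range (n + 1), descentInd (window β) i) + (negSet (window β)).card := by
  have h1 : ndes β = ∑ i ∈ des β, 1 + (negPos β).card := by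
    rw [ndes, NDes, Multiset.card_add, Multiset.card_map, ← Finset.card_eq_sum_ones]
    rfl
  rw [h1, sum_des β fun _ => 1, card_negPos]
  simp only [one_mul]

theorem dmaj_eq {n : ℕ} (β : B n) : dmaj β =
    (∑ i ∈ Finset.range (n + 1), i * descentInd (window β) i) +
      ∑ a ∈ negSet (window β), a := by
  have hw := isWindow_window β
  have h1 : dmaj β = ∑ i ∈ des β, i + ∑ i ∈ negPos β, (-entry β i - 1).toNat := by
    rw [dmaj, DDes, (sum_card_filter_ne_zero _).1, Multiset.sum_add,
      ← Finset.sum_eq_multiset_sum, Finset.sum]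
    simp
  rw [h1, sum_des β fun i => i, sum_negPos β fun x => (-x - 1).toNat, sum_negSet hw]
  congr 1
  refine Finset.sum_congr rfl fun i _ => ?_
  have := hw.1 i
  split_ifs <;> omega

theorem ddes_eq {n : ℕ} (β : B n) : ddes β =
    (∑ i ∈ Finset.range (n + 1), descentInd (window β) i) +
      ∑ a ∈ negSet (window β), if a = 0 then 0 else 1 := by
  have hw := isWindow_window β
  have h1 : ddes β = (∑ i ∈ des β, if i = 0 then 0 else 1) +
      ∑ i ∈ negPos β, if (-entry β i - 1).toNat = 0 then 0 else 1 := by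
    rw [ddes, DDes, (sum_card_filter_ne_zero _).2, Multiset.map_add, Multiset.sum_add,
      Multiset.map_map]
    rfl
  rw [h1, sum_des β fun i => if i = 0 then 0 else 1,
    sum_negPos β fun x => if (-x - 1).toNat = 0 then 0 else 1, sum_negSet hw]
  congr 1
  · refine Finset.sum_congr rfl fun i _ => ?_
    by_cases h : i = 0
    · simp [h, descentInd]
    · simp [h]
  · refine Finset.sum_congr rfl fun i _ => ?_
    have := hw.1 i
    split_ifs <;> omega

theorem lengthB_eq_negSet {n : ℕ} (β : B n) :
    lengthB β = inversions (window β) + ∑ a ∈ negSet (window β), (a + 1) := by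
  have hw := isWindow_window β
  rw [lengthB_eq, negPairs_eq hw, negCount_eq hw, Finset.sum_add_distrib, Finset.card_eq_sum_ones,
    add_assoc]

theorem lengthD_eq_negSet {n : ℕ} (β : B n) (h : Even (negSet (window β)).card) :
    lengthD β = inversions (window β) + ∑ a ∈ negSet (window β), a := by
  have hw := isWindow_window β
  rw [lengthD_eq β (by rwa [negCount_eq hw]), negPairs_eq hw]

/-! ### Factorization of the sums over `B_n` and `D_n` -/

/-- The monomial `t^maj q^inv p^des` of a word. -/
noncomputable def wordMonomial {R : Type*} [CommRing R] (t q p : R) {α : Type*} [LinearOrder α]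
    {n : ℕ} (w : Fin n → α) : R :=
  q ^ inversions w * (t ^ (∑ i ∈ Finset.range (n + 1), i * descentInd w i) *
    p ^ ∑ i ∈ Finset.range (n + 1), descentInd w i)

theorem wordMonomial_comp {R : Type*} [CommRing R] (t q p : R) {α γ : Type*} [LinearOrder α]
    [LinearOrder γ] {n : ℕ} (w : Fin n → α) (f : α → γ) (hf : StrictMono f) :
    wordMonomial t q p (f ∘ w) = wordMonomial t q p w := by
  have hd : descentInd (f ∘ w) = descentInd w := by
    funext i
    simp only [descentInd, Function.comp_apply, hf.lt_iff_lt]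
  have hi : inversions (f ∘ w) = inversions w := by
    simp only [inversions, Function.comp_apply, hf.lt_iff_lt]
  rw [wordMonomial, wordMonomial, hd, hi]

theorem monomialB_eq {R : Type*} [CommRing R] (t q p : R) {n : ℕ} (β : B n) :
    t ^ nmaj β * q ^ lengthB β * p ^ ndes β =
      wordMonomial t q p (window β) * ∏ a ∈ negSet (window β), (t * q) ^ (a + 1) * p := by
  rw [nmaj_eq, ndes_eq, lengthB_eq_negSet, wordMonomial, Finset.prod_mul_distrib,
    Finset.prod_pow_eq_pow_sum, Finset.prod_const]
  ring

theorem monomialD_eq {R : Type*} [CommRing R] (t q p : R) {n : ℕ} (β : B n)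
    (h : Even (negSet (window β)).card) :
    t ^ dmaj β * q ^ lengthD β * p ^ ddes β =
      wordMonomial t q p (window β) *
        ∏ a ∈ negSet (window β), (t * q) ^ a * p ^ (if a = 0 then 0 else 1) := by
  rw [dmaj_eq, ddes_eq, lengthD_eq_negSet β h, wordMonomial, Finset.prod_mul_distrib,
    Finset.prod_pow_eq_pow_sum, Finset.prod_pow_eq_pow_sum]
  ring

/-- The entry of absolute value `a + 1` in the windows with negative set `S`. -/
def signedValue (S : Finset ℕ) (a : ℕ) : ℤ := if a ∈ S then -((a : ℤ) + 1) else (a : ℤ) + 1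

theorem natAbs_signedValue (S : Finset ℕ) (a : ℕ) : (signedValue S a).natAbs = a + 1 := by
  rw [signedValue]
  split_ifs <;> omega

theorem signedValue_injective (S : Finset ℕ) : Function.Injective (signedValue S) := fun a b h => by
  have := congrArg Int.natAbs h
  simpa only [natAbs_signedValue, Nat.add_right_cancel_iff] using this

theorem card_image_signedValue (S : Finset ℕ) (n : ℕ) :
    ((Finset.range n).image (signedValue S)).card = n := by
  rw [Finset.card_image_of_injective _ (signedValue_injective S), Finset.card_range]

/-- The increasing window with negative set `S`. -/
noncomputable def sortedWindow (S : Finset ℕ) (n : ℕ) : Fin n ↪o ℤ :=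
  ((Finset.range n).image (signedValue S)).orderEmbOfFin (card_image_signedValue S n)

theorem exists_signedValue_eq (S : Finset ℕ) {n : ℕ} (i : Fin n) :
    ∃ a < n, signedValue S a = sortedWindow S n i := by
  obtain ⟨a, ha, h⟩ := Finset.mem_image.1
    (Finset.orderEmbOfFin_mem _ (card_image_signedValue S n) i)
  exact ⟨a, Finset.mem_range.1 ha, h⟩

theorem exists_sortedWindow_eq (S : Finset ℕ) {n a : ℕ} (ha : a < n) :
    ∃ i : Fin n, sortedWindow S n i = signedValue S a := by
  have : signedValue S a ∈ Set.range (sortedWindow S n) := by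
    rw [sortedWindow, Finset.range_orderEmbOfFin]
    simpa using ⟨a, ha, rfl⟩
  exact this

theorem isWindow_sortedWindow_comp (S : Finset ℕ) {n : ℕ} (π : Equiv.Perm (Fin n)) :
    IsWindow (sortedWindow S n ∘ π) := by
  constructor
  · intro i
    obtain ⟨a, ha, h⟩ := exists_signedValue_eq S (π i)
    have := natAbs_signedValue S a
    rw [Function.comp_apply, ← h]
    omega
  · intro i j hij
    obtain ⟨a, ha, h⟩ := exists_signedValue_eq S (π i)
    obtain ⟨b, hb, h'⟩ := exists_signedValue_eq S (π j)
    simp only [Function.comp_apply, ← h, ← h', natAbs_signedValue] at hij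
    obtain rfl : a = b := by omega
    exact π.injective ((sortedWindow S n).injective (h.symm.trans h'))

theorem negSet_sortedWindow_comp {S : Finset ℕ} {n : ℕ} (hS : S ⊆ Finset.range n)
    (π : Equiv.Perm (Fin n)) : negSet (sortedWindow S n ∘ π) = S := by
  ext a
  simp only [negSet, Finset.mem_image, Finset.mem_filter, Finset.mem_univ, true_and,
    Function.comp_apply]
  constructor
  · rintro ⟨i, hi, rfl⟩
    obtain ⟨a, ha, h⟩ := exists_signedValue_eq S (π i)
    rw [← h] at hi ⊢
    rw [natAbs_signedValue, Nat.add_sub_cancel]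
    by_contra hc
    rw [signedValue, if_neg hc] at hi
    omega
  · intro ha
    obtain ⟨i, hi⟩ := exists_sortedWindow_eq S (Finset.mem_range.1 (hS ha))
    refine ⟨π.symm i, ?_, ?_⟩
    · rw [Equiv.apply_symm_apply, hi, signedValue, if_pos ha]
      omega
    · rw [Equiv.apply_symm_apply, hi, natAbs_signedValue, Nat.add_sub_cancel]

theorem exists_perm_window {n : ℕ} {w : Fin n → ℤ} (hw : IsWindow w) :
    ∃ π : Equiv.Perm (Fin n), sortedWindow (negSet w) n ∘ π = w := by
  have h : ∀ i, ∃ j, sortedWindow (negSet w) n j = w i := fun i => by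
    have h1 := hw.1 i
    obtain ⟨j, hj⟩ := exists_sortedWindow_eq (negSet w) (n := n) (a := (w i).natAbs - 1) (by omega)
    refine ⟨j, hj.trans ?_⟩
    simp only [signedValue, mem_negSet_iff hw]
    split_ifs <;> omega
  choose f hf using h
  have hinj : Function.Injective f := fun i j hij => by
    apply hw.2
    simp only [← hf, hij]
  exact ⟨Equiv.ofBijective f (Finite.injective_iff_bijective.1 hinj), funext hf⟩

/-- The windows with negative set `S` are `sortedWindow S n ∘ π`, one for each `π`, and an
increasing relabelling preserves descents and inversions. -/
theorem sum_negSet_eq {R : Type*} [CommRing R] (t q p : R) {n : ℕ} {S : Finset ℕ}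
    (hS : S ⊆ Finset.range n) :
    ∑ β : B n with negSet (window β) = S, wordMonomial t q p (window β) =
      permSum t q p n := by
  have hex : ∀ π : Equiv.Perm (Fin n), ∃ β : B n, window β = sortedWindow S n ∘ π := fun π =>
    exists_window _ (isWindow_sortedWindow_comp S π)
  choose b hb using hex
  symm
  refine Finset.sum_bij (fun π _ => b π) (fun π _ => ?_) (fun π _ τ _ h => ?_) (fun β hβ => ?_)
    (fun π _ => ?_)
  · rw [Finset.mem_filter, hb]
    exact ⟨Finset.mem_univ _, negSet_sortedWindow_comp hS π⟩
  · have h1 := congrArg window h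
    rw [hb, hb] at h1
    exact Equiv.ext fun i => (sortedWindow S n).injective (congrFun h1 i)
  · obtain ⟨π, hπ⟩ := exists_perm_window (isWindow_window β)
    refine ⟨π, Finset.mem_univ _, window_injective ?_⟩
    rw [hb, ← (Finset.mem_filter.1 hβ).2, hπ]
  · rw [hb, wordMonomial_comp _ _ _ _ _ (sortedWindow S n).strictMono]
    rfl

/-- `P` is trivial for type B and evenness of the cardinality for type D. -/
theorem sum_windows {R : Type*} [CommRing R] (t q p : R) (n : ℕ) (P : Finset ℕ → Prop)
    [DecidablePred P] (g : ℕ → R) :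
    ∑ β : B n with P (negSet (window β)),
        wordMonomial t q p (window β) * ∏ a ∈ negSet (window β), g a =
      (∑ S ∈ (Finset.range n).powerset with P S, ∏ a ∈ S, g a) * permSum t q p n := by
  rw [← Finset.sum_fiberwise_of_maps_to (s := {β : B n | P (negSet (window β))})
    (t := {S ∈ (Finset.range n).powerset | P S}) (g := fun β => negSet (window β)),
    Finset.sum_mul]
  · refine Finset.sum_congr rfl fun S hS => ?_
    rw [Finset.mem_filter, Finset.mem_powerset] at hS
    rw [← sum_negSet_eq t q p hS.1, Finset.mul_sum, Finset.filter_filter]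
    refine Finset.sum_congr ?_ fun β hβ => ?_
    · ext β
      simp only [Finset.mem_filter, Finset.mem_univ, true_and]
      exact ⟨fun h => h.2, fun h => ⟨h ▸ hS.2, h⟩⟩
    · rw [(Finset.mem_filter.1 hβ).2, mul_comm]
  · intro β hβ
    rw [Finset.mem_filter, Finset.mem_powerset]
    exact ⟨negSet_subset (isWindow_window β), (Finset.mem_filter.1 hβ).2⟩

theorem sum_B_eq {R : Type*} [CommRing R] (t q p : R) (n : ℕ) :
    ∑ β : B n, t ^ nmaj β * q ^ lengthB β * p ^ ndes β =
      qPoch (-(t * q * p)) (t * q) n * permSum t q p n := by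
  have h := sum_windows t q p n (fun _ => True) fun a => (t * q) ^ (a + 1) * p
  simp only [Finset.filter_true] at h
  simp only [monomialB_eq, h]
  rw [← Finset.prod_one_add, qPoch]
  congr 1
  exact Finset.prod_congr rfl fun i _ => by ring

/-- Every subset of `{1, …, n}` becomes even in exactly one way by adding or not adding `0`, whose
weight is `1`. -/
theorem sum_even_powerset {R : Type*} [CommRing R] (n : ℕ) (g : ℕ → R) (h0 : g 0 = 1) :
    ∑ S ∈ (Finset.range (n + 1)).powerset with Even S.card, ∏ a ∈ S, g a =
      ∏ i ∈ Finset.range n, (1 + g (i + 1)) := by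
  have hr : Finset.range (n + 1) = insert 0 (Finset.Ico 1 (n + 1)) := by
    ext a
    simp only [Finset.mem_range, Finset.mem_insert, Finset.mem_Ico]
    omega
  have hn : 0 ∉ Finset.Ico 1 (n + 1) := by simp
  have hp : ∏ i ∈ Finset.range n, (1 + g (i + 1)) = ∏ i ∈ Finset.Ico 1 (n + 1), (1 + g i) := by
    rw [Finset.range_eq_Ico, Finset.prod_Ico_add' (fun i => 1 + g i) 0 n 1, zero_add]
  rw [hp, Finset.prod_one_add, Finset.sum_filter, hr, Finset.sum_powerset_insert hn,
    ← Finset.sum_add_distrib]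
  refine Finset.sum_congr rfl fun S hS => ?_
  have h1 : 0 ∉ S := fun h => hn (Finset.mem_powerset.1 hS h)
  rw [Finset.card_insert_of_notMem h1, Finset.prod_insert h1, h0, one_mul]
  by_cases h : Even S.card <;> simp [h, Nat.even_add_one]

theorem sum_D_eq {R : Type*} [CommRing R] (t q p : R) (n : ℕ) :
    ∑ γ ∈ D (n + 1), t ^ dmaj γ * q ^ lengthD γ * p ^ ddes γ =
      qPoch (-(t * q * p)) (t * q) n * permSum t q p (n + 1) := by
  have h := sum_windows t q p (n + 1) (fun S => Even S.card) fun a =>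
    (t * q) ^ a * p ^ (if a = 0 then 0 else 1)
  rw [sum_even_powerset _ _ (by simp)] at h
  have hq : ∏ i ∈ Finset.range n, (1 + (t * q) ^ (i + 1) * p ^ (if i + 1 = 0 then 0 else 1)) =
      qPoch (-(t * q * p)) (t * q) n :=
    Finset.prod_congr rfl fun i _ => by rw [if_neg (Nat.succ_ne_zero i)]; ring
  rw [← hq, ← h, D]
  simp only [card_negPos]
  exact Finset.sum_congr rfl fun γ hγ => monomialD_eq t q p γ (Finset.mem_filter.1 hγ).2

end GesselBD

theorem mainTheorem8 {K : Type*} [Field K] [TopologicalSpace K] [DiscreteTopology K]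
    (t q p u : MvPowerSeries (Fin 4) K)
    (ht : t = MvPowerSeries.X 0) (hq : q = MvPowerSeries.X 1)
    (hp : p = MvPowerSeries.X 2) (hu : u = MvPowerSeries.X 3) :
    (Summable (fun k : ℕ => p ^ k * ∏ i ∈ Finset.range (k + 1), GesselBD.qExp q (t ^ i * u)) ∧
      Summable (fun n : ℕ => u ^ n * (GesselBD.qFact q n)⁻¹ *
        ((∑ β : GesselBD.B n,
            t ^ GesselBD.nmaj β * q ^ GesselBD.lengthB β * p ^ GesselBD.ndes β) *
          (GesselBD.qPoch (-(t * q * p)) (t * q) n * GesselBD.qPoch p t (n + 1))⁻¹)) ∧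
      Summable (fun n : ℕ => u ^ (n + 1) * (GesselBD.qFact q (n + 1))⁻¹ *
        ((∑ γ ∈ GesselBD.D (n + 1),
            t ^ GesselBD.dmaj γ * q ^ GesselBD.lengthD γ * p ^ GesselBD.ddes γ) *
          (GesselBD.qPoch (-(t * q * p)) (t * q) n * GesselBD.qPoch p t (n + 2))⁻¹))) ∧
    ∑' n : ℕ, u ^ n * (GesselBD.qFact q n)⁻¹ *
        ((∑ β : GesselBD.B n,
            t ^ GesselBD.nmaj β * q ^ GesselBD.lengthB β * p ^ GesselBD.ndes β) *
          (GesselBD.qPoch (-(t * q * p)) (t * q) n * GesselBD.qPoch p t (n + 1))⁻¹) =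
      ∑' k : ℕ, p ^ k * ∏ i ∈ Finset.range (k + 1), GesselBD.qExp q (t ^ i * u) ∧
    (1 - p)⁻¹ + ∑' n : ℕ, u ^ (n + 1) * (GesselBD.qFact q (n + 1))⁻¹ *
        ((∑ γ ∈ GesselBD.D (n + 1),
            t ^ GesselBD.dmaj γ * q ^ GesselBD.lengthD γ * p ^ GesselBD.ddes γ) *
          (GesselBD.qPoch (-(t * q * p)) (t * q) n * GesselBD.qPoch p t (n + 2))⁻¹) =
      ∑' k : ℕ, p ^ k * ∏ i ∈ Finset.range (k + 1), GesselBD.qExp q (t ^ i * u) := by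
  have hq0 : MvPowerSeries.constantCoeff q = 0 := by rw [hq, MvPowerSeries.constantCoeff_X]
  have hp0 : MvPowerSeries.constantCoeff p = 0 := by rw [hp, MvPowerSeries.constantCoeff_X]
  have hu0 : MvPowerSeries.constantCoeff u = 0 := by rw [hu, MvPowerSeries.constantCoeff_X]
  have ha : MvPowerSeries.constantCoeff (-(t * q * p)) = 0 := by simp [hp0]
  obtain ⟨s, hs, hk⟩ := GesselBD.exists_hasSum_permSum t q p u hq0 hp0 hu0
  -- Both signed series become the one for the symmetric groups, the type D series without its term
  -- at `n = 0`.
  simp only [GesselBD.sum_B_eq, GesselBD.sum_D_eq, GesselBD.mul_inv_qPoch_mul _ _ _ _ _ ha]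
  have hD := (summable_nat_add_iff 1).2 hs.summable
  refine ⟨⟨hk.summable, hs.summable, hD⟩, hs.tsum_eq.trans hk.tsum_eq.symm, ?_⟩
  -- The missing term at `n = 0` is `1/(p;t)_1 = (1 - p)⁻¹`.
  rw [hk.tsum_eq, ← hs.tsum_eq, hs.summable.tsum_eq_zero_add]
  congr 1
  simp [GesselBD.permSum_zero, GesselBD.qFact, GesselBD.qPoch]
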